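/- All graphs are finite and simple. A *path* in a graph $G$ is an induced subgraph of $G$ that is a path; its interior $P^*$ is its set of non-end vertices, and its length is its number of edges. A *hole* is an induced cycle of length at least four (its length being its number of vertices). Two sets of vertices are *anticomplete* if there is no edge between them. A *theta* is a graph consisting of two non-adjacent vertices $a,b$ and three paths from $a$ to $b$ of length at least two, whose interiors are pairwise disjoint and anticomplete to each other. A *pyramid* is a graph consisting of a vertex $a$, a triangle $\{b_1,b_2,b_3\}$ and paths $P_i$ from $a$ to $b_i$ ($i=1,2,3$) of length at least one, at most one of which has length exactly one, pairwise disjoint except at $a$, such that for $i\ne j$ the only edge between $P_i\setminus\{a\}$ and $P_j\setminus\{a\}$ is $b_ib_j$. A *prism* is a graph consisting of two triangles $\{a_1,a_2,a_3\}$, $\{b_1,b_2,b_3\}$ and pairwise disjoint paths $P_i$ from $a_i$ to $b_i$ ($i=1,2,3$) of length at least one, such that for $i\neq j$ the only edges between $P_i$ and $P_j$ are $a_ia_j$ and $b_ib_j$. A *pinched prism* is a graph consisting of a hole $H$ of length at least six and a vertex $c \notin H$ whose neighbours in $H$ are four distinct vertices inducing exactly two disjoint edges. A *generalized prism* is a prism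 or a pinched prism. For an integer $t\ge 1$, $\mathcal C_t$ is the class of graphs with no induced subgraph isomorphic to a theta, a pyramid, a generalized prism, or the complete graph $K_t$. Let $W$ be a hole of $G$ and $v\in V(G)\setminus W$. A *sector* of $(W,v)$ is a path $P$ of $W$ of length at least one such that both ends of $P$ are adjacent to $v$ and $v$ is anticomplete to $P^*$; it is *long* if $P^*\neq\emptyset$. The pair $(W,v)$ is a *wheel* in $G$ if $W$ has length at least five, $v$ has at least three neighbours in $W$, and $(W,v)$ has at least two long sectors. A vertex $v$ is a *hub* in $G$ if $(W,v)$ is a wheel in $G$ for some $W$; $\mathrm{Hub}(G)$ is the set of hubs of $G$. A graph is *chordal* if it has no hole. For a set $F\subseteq\binom{V(G)}{2}\setminus E(G)$, let $G+F$ be the graph obtained from $G$ by making the pairs in $F$ adjacent; $F$ is a *chordal completion* of $G$ if $G+F$ is chordal, and it is *minimal* if it is inclusion-wise minimal with this property. A *potential maximal clique* of $G$ is a set $X\subseteq V(G)$ that is an (inclusion-wise) maximal clique of $G+F$ for some minimal chordal completion $F$ of $G$. The *Ramsey number* $R(t,s)$ is the minimum integer such that every graph on at least $R(t,s)$ vertices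 contains a clique of size $t$ or a stable set of size $s$. **Theorem 4.4.** Let $t\ge 1$, let $G\in\mathcal C_t$, and let $X$ be a potential maximal clique of $G$. If $Y\subseteq X\setminus\mathrm{Hub}(G)$ is a stable set of $G$, then $|Y|\le 3$. Consequently, $|X\setminus\mathrm{Hub}(G)|\le R(t,4)$. -/

import Mathlib

namespace SimpleGraph

variable {V : Type*}

/-- A path in `G` in the sense of induced subgraphs: the walk `p` repeats no vertex, and every edge
of `G` between two of its vertices is an edge of `p`. -/
def IsInducedPath (G : SimpleGraph V) {x y : V} (p : G.Walk x y) : Prop :=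
  p.IsPath ∧ p.IsChordless

/-- The interior `P^*` of a path `P` from `x` to `y`: its vertices other than its ends. -/
def pathInterior (G : SimpleGraph V) {x y : V} (p : G.Walk x y) : Set V :=
  {z | z ∈ p.support} \ {x, y}

/-- There are no edges of `G` between `A` and `B`. -/
def Anticomplete (G : SimpleGraph V) (A B : Set V) : Prop :=
  ∀ x ∈ A, ∀ y ∈ B, ¬ G.Adj x y

/-- `W` is (the vertex set of) a hole of `G`: an induced cycle of length at least four.
The length of the hole is `W.ncard`. -/
def IsHole (G : SimpleGraph V) (W : Set V) : Prop :=
  ∃ (u : V) (c : G.Walk u u),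
    c.IsCycle ∧ c.IsChordless ∧ 4 ≤ c.length ∧ {z | z ∈ c.support} = W

/-- `G` contains a theta as an induced subgraph: two non-adjacent vertices `a`, `b` and three paths
of length at least two from `a` to `b`, whose interiors are pairwise disjoint and anticomplete. -/
def ContainsTheta (G : SimpleGraph V) : Prop :=
  ∃ (a b : V) (P : Fin 3 → G.Walk a b),
    ¬ G.Adj a b ∧
    (∀ i, G.IsInducedPath (P i) ∧ 2 ≤ (P i).length) ∧
    ∀ i j, i ≠ j →
      Disjoint (G.pathInterior (P i)) (G.pathInterior (P j)) ∧
      G.Anticomplete (G.pathInterior (P i)) (G.pathInterior (P j))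

/-- `G` contains a pyramid as an induced subgraph: an apex `a`, a triangle `b 0, b 1, b 2`, and paths
`P i` from `a` to `b i` of length at least one, at most one of which has length exactly one, which
are disjoint apart from `a`, the only edge between `P i \ {a}` and `P j \ {a}` being that from `b i`
to `b j`. -/
def ContainsPyramid (G : SimpleGraph V) : Prop :=
  ∃ (a : V) (b : Fin 3 → V) (P : ∀ i, G.Walk a (b i)),
    (∀ i j, i ≠ j → G.Adj (b i) (b j)) ∧
    (∀ i, G.IsInducedPath (P i) ∧ 1 ≤ (P i).length) ∧
    (∀ i j, i ≠ j → ¬ ((P i).length = 1 ∧ (P j).length = 1)) ∧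
    ∀ i j, i ≠ j → ∀ x ∈ (P i).support, ∀ y ∈ (P j).support, x ≠ a → y ≠ a →
      x ≠ y ∧ (G.Adj x y → x = b i ∧ y = b j)

/-- `G` contains a prism as an induced subgraph: triangles `a 0, a 1, a 2` and `b 0, b 1, b 2`, and
pairwise disjoint paths `P i` from `a i` to `b i` of length at least one, the only edges between
`P i` and `P j` being that from `a i` to `a j` and that from `b i` to `b j`. -/
def ContainsPrism (G : SimpleGraph V) : Prop :=
  ∃ (a b : Fin 3 → V) (P : ∀ i, G.Walk (a i) (b i)),
    (∀ i j, i ≠ j → G.Adj (a i) (a j)) ∧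
    (∀ i j, i ≠ j → G.Adj (b i) (b j)) ∧
    (∀ i, G.IsInducedPath (P i) ∧ 1 ≤ (P i).length) ∧
    ∀ i j, i ≠ j → ∀ x ∈ (P i).support, ∀ y ∈ (P j).support,
      x ≠ y ∧ (G.Adj x y → (x = a i ∧ y = a j) ∨ (x = b i ∧ y = b j))

/-- `G` contains a pinched prism as an induced subgraph: a hole `W` of length at least six and a
vertex `c` outside `W` whose neighbours in `W` are four distinct vertices `p, q, r, s`, the edges
among these being exactly `pq` and `rs`. -/
def ContainsPinchedPrism (G : SimpleGraph V) : Prop :=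
  ∃ (W : Set V) (c p q r s : V),
    G.IsHole W ∧ 6 ≤ W.ncard ∧ c ∉ W ∧
    W ∩ G.neighborSet c = {p, q, r, s} ∧
    [p, q, r, s].Nodup ∧
    G.Adj p q ∧ G.Adj r s ∧ ¬ G.Adj p r ∧ ¬ G.Adj p s ∧ ¬ G.Adj q r ∧ ¬ G.Adj q s

/-- The class of (theta, pyramid, generalized prism, `K_t`)-free graphs, where a generalized prism
is a prism or a pinched prism. -/
def InClassC (t : ℕ) (G : SimpleGraph V) : Prop :=
  ¬ G.ContainsTheta ∧ ¬ G.ContainsPyramid ∧ ¬ G.ContainsPrism ∧ ¬ G.ContainsPinchedPrism ∧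
    G.CliqueFree t

/-- `S` is the vertex set of a long sector of `(W, v)`: a path of the hole `W` of length at least one
whose ends are both adjacent to `v`, whose interior is anticomplete to `v`, and whose interior is
non-empty. -/
def IsLongSector (G : SimpleGraph V) (W : Set V) (v : V) (S : Set V) : Prop :=
  ∃ (x y : V) (p : G.Walk x y),
    G.IsInducedPath p ∧ 1 ≤ p.length ∧ {z | z ∈ p.support} = S ∧ S ⊆ W ∧
    G.Adj v x ∧ G.Adj v y ∧
    G.Anticomplete {v} (G.pathInterior p) ∧ (G.pathInterior p).Nonempty

/-- `(W, v)` is a wheel in `G`: `W` is a hole of length at least five, and `v` is a vertex outside `W`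
with at least three neighbours in `W` such that `(W, v)` has at least two long sectors. -/
def IsWheel (G : SimpleGraph V) (W : Set V) (v : V) : Prop :=
  G.IsHole W ∧ 5 ≤ W.ncard ∧ v ∉ W ∧ 3 ≤ (W ∩ G.neighborSet v).ncard ∧
    ∃ S T : Set V, S ≠ T ∧ G.IsLongSector W v S ∧ G.IsLongSector W v T

/-- The set `Hub(G)` of hubs of `G`. -/
def hubs (G : SimpleGraph V) : Set V :=
  {v | ∃ W, G.IsWheel W v}

/-- A graph is chordal if it has no hole. -/
def IsChordalGraph (G : SimpleGraph V) : Prop :=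
  ∀ W, ¬ G.IsHole W

/-- The graph `G + F`, obtained from `G` by making the pairs in `F` adjacent. -/
def addPairs (G : SimpleGraph V) (F : Set (Sym2 V)) : SimpleGraph V :=
  G ⊔ fromEdgeSet F

/-- `F` is a chordal completion of `G`: a set of pairs of distinct non-adjacent vertices of `G`
such that `G + F` is chordal. -/
def IsChordalCompletion (G : SimpleGraph V) (F : Set (Sym2 V)) : Prop :=
  F ⊆ Gᶜ.edgeSet ∧ (G.addPairs F).IsChordalGraph

/-- `X` is a potential maximal clique of `G`: an inclusion-wise maximal clique of `G + F` for some
inclusion-wise minimal chordal completion `F` of `G`. -/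
def IsPMC (G : SimpleGraph V) (X : Set V) : Prop :=
  ∃ F, Minimal G.IsChordalCompletion F ∧ Maximal (G.addPairs F).IsClique X

/-- Every graph on at least `N` vertices has a clique of size `t` or a stable set of size `s`. -/
def RamseyBound (t s N : ℕ) : Prop :=
  ∀ n, N ≤ n → ∀ H : SimpleGraph (Fin n), ¬ H.CliqueFree t ∨ ¬ H.IndepSetFree s

/-- The Ramsey number `R(t, s)`: the least `N` with `RamseyBound t s N`
(such `N` exist by `exists_ramseyBound`). -/
noncomputable def ramseyNumber (t s : ℕ) : ℕ :=
  sInf {N | RamseyBound t s N}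

theorem exists_ramsey_finset (t s : ℕ) : ∃ N : ℕ, ∀ (V : Type) (H : SimpleGraph V) (A : Finset V),
    N ≤ A.card → (∃ B ⊆ A, H.IsNClique t B) ∨ ∃ B ⊆ A, H.IsNIndepSet s B := by
  classical
  induction t generalizing s with
  | zero => exact ⟨0, fun V H A _ => Or.inl ⟨∅, by simp, by simp⟩⟩
  | succ t iht =>
    induction s with
    | zero => exact ⟨0, fun V H A _ => Or.inr ⟨∅, by simp, by simp [isNIndepSet_iff]⟩⟩
    | succ s ihs =>
      obtain ⟨M, hM⟩ := iht (s + 1)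
      obtain ⟨N, hN⟩ := ihs
      refine ⟨M + N + 1, fun V H A hA => ?_⟩
      obtain ⟨v, hv⟩ : A.Nonempty := Finset.card_pos.mp (by omega)
      have hcard := Finset.card_filter_add_card_filter_not (s := A.erase v) (fun x => H.Adj v x)
      rw [Finset.card_erase_of_mem hv] at hcard
      have hsub : ∀ (p : V → Prop) [DecidablePred p], (A.erase v).filter p ⊆ A := fun p _ =>
        (Finset.filter_subset _ _).trans (Finset.erase_subset _ _)
      rcases Nat.lt_or_ge ((A.erase v).filter (fun x => H.Adj v x)).card M with h | h
      · rcases hN V H ((A.erase v).filter (fun x => ¬ H.Adj v x)) (by omega) with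
          ⟨B, hB, hc⟩ | ⟨B, hB, hc⟩
        · exact Or.inl ⟨B, hB.trans (hsub _), hc⟩
        · refine Or.inr ⟨insert v B, Finset.insert_subset hv (hB.trans (hsub _)), ?_⟩
          rw [← isNClique_compl] at hc ⊢
          refine hc.insert fun b hb => ?_
          have := Finset.mem_filter.mp (hB hb)
          exact (compl_adj _ _ _).mpr ⟨(Finset.ne_of_mem_erase this.1).symm, this.2⟩
      · rcases hM V H _ h with ⟨B, hB, hc⟩ | ⟨B, hB, hc⟩
        · refine Or.inl ⟨insert v B, Finset.insert_subset hv (hB.trans (hsub _)), ?_⟩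
          exact hc.insert fun b hb => (Finset.mem_filter.mp (hB hb)).2
        · exact Or.inr ⟨B, hB.trans (hsub _), hc⟩

theorem exists_ramseyBound (t s : ℕ) : ∃ N, RamseyBound t s N := by
  obtain ⟨N, hN⟩ := exists_ramsey_finset t s
  refine ⟨N, fun n hn H => ?_⟩
  rcases hN (Fin n) H Finset.univ (by simpa using hn) with ⟨B, -, hB⟩ | ⟨B, -, hB⟩
  · exact Or.inl fun h => h B hB
  · exact Or.inr fun h => h B hB

end SimpleGraph

/-!
The hubs enter through one statement about two disjoint anticomplete connected sets `A` and `B`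
(`TwoSided.exists_mem_hubs`): if three pairwise non-adjacent vertices `y 0, y 1, y 2` all have
neighbours in `A` and in `B`, and the graph contains no theta, pyramid or prism, then one of them is
a hub. Inside `A`, the three vertices are joined
by an induced claw (three paths from a common centre) or by a triangle with three paths
leaving it (`ConnectedIn.exists_isClaw_or_isTri`), and the same holds inside `B`. Two claws together
form a theta, a claw and a triangle form a pyramid, and two triangles form a prism. The exceptions
are the degenerate cases in which some `y k` is too close to the centre or to the triangle on both
sides. In these, `y k` is a *middle vertex* on both sides: it has a neighbour on a path through `A`
and on a path through `B` between the two others. Those two paths form a hole, for which `y k` is a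
hub unless it has one neighbour on each path, and then there is a theta
(`TwoSided.mem_hubs_of_isMiddle`). To cover the case of a middle vertex with non-adjacent
neighbours on its path without a third type, a claw is allowed to be centred at a middle vertex.

Two facts on a potential maximal clique `X` are needed. Any two non-adjacent vertices of `X`
have neighbours in a common component of `G \ X` (`IsPMC.exists_common_outComp`): a minimal
completion cannot be made smaller at a single pair, so a fill edge is the only chord of a cycle of
length four; and it cannot have edges across a clique separator (`not_adj_of_separator`), so the components of
`G \ X` have the same neighbours in `G` and in the completion. No component of `G \ X` is attached
to all of `X` (`IsPMC.exists_not_adj_outComp`), as in a chordal graph some vertex of it would extend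
the clique `X`. For a component `D` of `G \ X`, these facts make the part of `G` beyond `N(D)` a
second connected set attached to all of `N(D)`, so that `N(D)` has no three pairwise non-adjacent
non-hubs (`IsPMC.exists_mem_hubs`). Hence, for four pairwise non-adjacent non-hubs in `X`, the six
pairs are joined through six different components. Paths through five of these already form a
theta.
-/

namespace SimpleGraph

variable {V : Type*} {G : SimpleGraph V}

/-! ### Induced paths, by their vertex sets -/

/-- `G.IndPath x y S` says that `S` is the vertex set of an induced path of `G` from `x` to `y`;
paths are grown at their first vertex. A single vertex is a path. -/
inductive IndPath (G : SimpleGraph V) : V → V → Set V → Prop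
  | nil (x : V) : IndPath G x x {x}
  | cons {x z y : V} {S : Set V} : G.Adj x z → IndPath G z y S → x ∉ S →
      (∀ w ∈ S, G.Adj x w → w = z) → IndPath G x y (insert x S)

/-- Apart from `y`, the sets `S` and `T` are disjoint and anticomplete. -/
def SepAt (G : SimpleGraph V) (S T : Set V) (y : V) : Prop :=
  ∀ u ∈ S, ∀ w ∈ T, u ≠ y → w ≠ y → u ≠ w ∧ ¬ G.Adj u w

theorem SepAt.symm {S T : Set V} {y : V} (h : G.SepAt S T y) : G.SepAt T S y :=
  fun u hu w hw hu' hw' => ⟨(h w hw u hu hw' hu').1.symm, fun e => (h w hw u hu hw' hu').2 e.symm⟩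

theorem SepAt.mono {S T S' T' : Set V} {y : V} (h : G.SepAt S T y) (hS : S' ⊆ S) (hT : T' ⊆ T) :
    G.SepAt S' T' y :=
  fun u hu w hw => h u (hS hu) w (hT hw)

namespace IndPath

theorem left_mem {x y : V} {S : Set V} (h : G.IndPath x y S) : x ∈ S := by
  cases h <;> simp

theorem right_mem {x y : V} {S : Set V} (h : G.IndPath x y S) : y ∈ S := by
  induction h with
  | nil x => simp
  | cons _ _ _ _ ih => exact Set.mem_insert_of_mem _ ih

theorem exists_adj_left {x y : V} {S : Set V} (h : G.IndPath x y S) (hxy : x ≠ y) :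
    ∃ z ∈ S, G.Adj x z := by
  cases h with
  | nil => exact absurd rfl hxy
  | cons e p _ _ => exact ⟨_, .inr p.left_mem, e⟩

theorem pair {x y : V} (h : G.Adj x y) : G.IndPath x y {x, y} :=
  .cons h (.nil y) (by simpa using h.ne) (by simp)

theorem append {x y z : V} {S T : Set V} (h₁ : G.IndPath x y S) (h₂ : G.IndPath y z T)
    (h : G.SepAt S T y) : G.IndPath x z (S ∪ T) := by
  induction h₁ with
  | nil x => rwa [Set.union_eq_right.mpr (by simpa using h₂.left_mem)]
  | @cons x w y S e p hx hw ih =>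
    rw [Set.insert_union]
    have hxy : x ≠ y := fun h => hx (h ▸ p.right_mem)
    refine .cons e (ih h₂ (h.mono (Set.subset_insert _ _) subset_rfl)) ?_ ?_
    · rintro (h' | h')
      · exact hx h'
      · exact (h x (by simp) x h' hxy hxy).1 rfl
    · rintro u (hu | hu) hxu
      · exact hw u hu hxu
      · by_cases huy : u = y
        · exact hw u (huy ▸ p.right_mem) hxu
        · exact absurd hxu (h x (by simp) u hu hxy huy).2

theorem symm {x y : V} {S : Set V} (h : G.IndPath x y S) : G.IndPath y x S := by
  induction h with
  | nil x => exact .nil x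
  | @cons x w y S e p hx hw ih =>
    have : insert x S = S ∪ {w, x} := by
      ext u
      have := p.left_mem
      simp only [Set.mem_insert_iff, Set.mem_union, Set.mem_singleton_iff]
      grind
    rw [this]
    refine ih.append (pair e.symm) ?_
    rintro u hu v (rfl | rfl) hu' hv'
    · exact absurd rfl hv'
    · exact ⟨fun h => hx (h ▸ hu), fun h => hu' (hw u hu h.symm)⟩

/-- Cutting an induced path at its first vertex in `N`. -/
theorem exists_first {x y : V} {S : Set V} (h : G.IndPath x y S) {N : Set V}
    (hN : ∃ z ∈ S, z ∈ N) :
    ∃ z ∈ N, ∃ S₁ S₂, G.IndPath x z S₁ ∧ G.IndPath z y S₂ ∧ S = S₁ ∪ S₂ ∧ G.SepAt S₁ S₂ z ∧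
      ∀ u ∈ S₁, u ∈ N → u = z := by
  induction h with
  | nil x =>
    obtain ⟨z, rfl, hz⟩ := hN
    exact ⟨z, hz, {z}, {z}, .nil z, .nil z, by simp, by rintro u rfl w rfl h; exact absurd rfl h,
      by simp⟩
  | @cons x w y S e p hx hw ih =>
    by_cases hxN : x ∈ N
    · exact ⟨x, hxN, {x}, insert x S, .nil x, .cons e p hx hw, by simp,
        by rintro u rfl w _ h; exact absurd rfl h, by simp⟩
    · obtain ⟨z, hz, S₁, S₂, h₁, h₂, rfl, hsep, hfst⟩ := ih (by
        obtain ⟨z, rfl | hz, hz'⟩ := hN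
        · exact absurd hz' hxN
        · exact ⟨z, hz, hz'⟩)
      refine ⟨z, hz, insert x S₁, S₂, .cons e h₁ (fun h => hx (.inl h))
        (fun u hu => hw u (.inl hu)), h₂, by rw [Set.insert_union], ?_, ?_⟩
      · rintro u (rfl | hu) v hv hu' hv'
        · refine ⟨fun h => hx (.inr (h ▸ hv)), fun h => ?_⟩
          obtain rfl := hw v (.inr hv) h
          exact (hsep v h₁.left_mem v hv hv' hv').1 rfl
        · exact hsep u hu v hv hu' hv'
      · rintro u (rfl | hu) hu'
        · exact absurd hu' hxN
        · exact hfst u hu hu'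

theorem exists_split {x y z : V} {S : Set V} (h : G.IndPath x y S) (hz : z ∈ S) :
    ∃ S₁ S₂, G.IndPath x z S₁ ∧ G.IndPath z y S₂ ∧ S = S₁ ∪ S₂ ∧ G.SepAt S₁ S₂ z := by
  obtain ⟨w, rfl, S₁, S₂, h₁, h₂, h₃, h₄, -⟩ := h.exists_first (N := {z}) ⟨z, hz, rfl⟩
  exact ⟨S₁, S₂, h₁, h₂, h₃, h₄⟩

theorem eq_singleton {x : V} {S : Set V} (h : G.IndPath x x S) : S = {x} := by
  cases h with
  | nil => rfl
  | cons _ p hx _ => exact absurd p.right_mem hx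

/-- Cutting an induced path at its first vertex `p` and its last vertex `q` in `N`. -/
theorem exists_first_last {x y : V} {S : Set V} (h : G.IndPath x y S) {N : Set V}
    (hN : ∃ z ∈ S, z ∈ N) :
    ∃ p ∈ N, ∃ q ∈ N, ∃ S₁ S₂ S₃, G.IndPath x p S₁ ∧ G.IndPath p q S₂ ∧ G.IndPath q y S₃ ∧
      S = S₁ ∪ S₂ ∪ S₃ ∧ G.SepAt S₁ (S₂ ∪ S₃) p ∧ G.SepAt (S₁ ∪ S₂) S₃ q ∧
      (∀ u ∈ S₁, u ∈ N → u = p) ∧ (∀ u ∈ S₃, u ∈ N → u = q) := by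
  obtain ⟨p, hp, S₁, T, h₁, h₂, rfl, h₃, h₄⟩ := h.exists_first hN
  obtain ⟨q, hq, S₃, S₂, k₁, k₂, rfl, k₃, k₄⟩ := h₂.symm.exists_first ⟨p, h₂.left_mem, hp⟩
  refine ⟨p, hp, q, hq, S₁, S₂, S₃, h₁, k₂.symm, k₁.symm, ?_, ?_, ?_, h₄, k₄⟩
  · rw [Set.union_assoc, Set.union_comm S₂]
  · rwa [Set.union_comm S₂]
  · rintro u (hu | hu) v hv hu' hv'
    · by_cases hup : u = p
      · subst hup; exact k₃.symm u k₂.right_mem v hv hu' hv'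
      · by_cases hvp : v = p
        · subst hvp
          exact absurd rfl (k₃ v hv v k₂.right_mem hv' hv').1
        · exact h₃ u hu v (.inl hv) hup hvp
    · exact k₃.symm u hu v hv hu' hv'

theorem exists_walk {x y : V} {S : Set V} (h : G.IndPath x y S) :
    ∃ p : G.Walk x y, G.IsInducedPath p ∧ {z | z ∈ p.support} = S := by
  induction h with
  | nil x => exact ⟨.nil, ⟨.nil, by simp [Walk.isChordless_iff_forall_mem_edges]⟩, by ext; simp⟩
  | @cons x w y S e p hx hw ih =>
    obtain ⟨q, ⟨hq, hc⟩, rfl⟩ := ih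
    refine ⟨.cons e q, ⟨hq.cons hx, ?_⟩, by ext; simp⟩
    rw [Walk.isChordless_iff_forall_mem_edges] at hc ⊢
    intro u v hu hv huv
    simp only [Walk.support_cons, List.mem_cons, Walk.edges_cons, Sym2.eq_iff] at hu hv ⊢
    rcases hu with rfl | hu <;> rcases hv with rfl | hv
    · exact absurd huv (G.irrefl)
    · exact .inl (.inl ⟨rfl, hw v hv huv⟩)
    · exact .inl (.inr ⟨hw u hu huv.symm, rfl⟩)
    · exact .inr (hc hu hv huv)

theorem of_walk {x y : V} (p : G.Walk x y) (hp : p.IsPath) (hc : p.IsChordless) :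
    G.IndPath x y {z | z ∈ p.support} := by
  induction p with
  | nil => simpa using IndPath.nil _
  | @cons x w y e p ih =>
    rw [Walk.isChordless_iff_forall_mem_edges] at hc
    rw [Walk.cons_isPath_iff] at hp
    have : {z | z ∈ (Walk.cons e p).support} = insert x {z | z ∈ p.support} := by ext; simp
    rw [this]
    have key : ∀ u ∈ p.support, G.Adj x u → u = w := fun u hu hxu => by
      have := hc (u' := x) (v' := u) (by simp) (by simp [hu]) hxu
      simp only [Walk.edges_cons, List.mem_cons] at this
      rcases this with h | h
      · simp only [Sym2.eq_iff] at h
        rcases h with h | h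
        · exact h.2
        · exact h.2.trans h.1 |>.trans (by grind)
      · exact absurd (p.fst_mem_support_of_mem_edges h) hp.2
    refine .cons e (ih hp.1 ?_) hp.2 key
    rw [Walk.isChordless_iff_forall_mem_edges]
    intro u v hu hv huv
    have := hc (u' := u) (v' := v) (by simp [hu]) (by simp [hv]) huv
    simp only [Walk.edges_cons, List.mem_cons] at this
    rcases this with h | h
    · simp only [Sym2.eq_iff] at h
      grind
    · exact h

/-- The vertices of a walk contain an induced path with the same ends. -/
theorem exists_of_walk {x y : V} (p : G.Walk x y) {A : Set V} (hA : ∀ z ∈ p.support, z ∈ A) :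
    ∃ S ⊆ A, G.IndPath x y S := by
  induction p with
  | nil => exact ⟨_, by simpa using hA, .nil _⟩
  | @cons x w y e p ih =>
    obtain ⟨S, hS, hp⟩ := ih fun z hz => hA z (by simp [hz])
    have hxA : x ∈ A := hA x (by simp)
    by_cases hx : x ∈ S
    · obtain ⟨S₁, S₂, -, h, rfl, -⟩ := hp.exists_split hx
      exact ⟨S₂, fun u hu => hS (.inr hu), h⟩
    · obtain ⟨z, hz, S₁, S₂, h₁, -, rfl, -, h₂⟩ :=
        hp.symm.exists_first (N := G.neighborSet x) ⟨w, hp.left_mem, e⟩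
      exact ⟨insert x S₁, Set.insert_subset hxA fun u hu => hS (.inl hu),
        .cons hz h₁.symm (fun h => hx (.inl h)) h₂⟩

theorem mono_of_adj_iff {G' : SimpleGraph V} {x y : V} {S : Set V} (h : G.IndPath x y S)
    (hG : ∀ u ∈ S, ∀ v ∈ S, G.Adj u v ↔ G'.Adj u v) : G'.IndPath x y S := by
  induction h with
  | nil x => exact .nil x
  | @cons x w y S e p hx hw ih =>
    refine .cons ((hG _ (by simp) _ (.inr p.left_mem)).1 e)
      (ih fun u hu v hv => hG u (.inr hu) v (.inr hv)) hx fun u hu h => hw u hu ?_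
    exact (hG _ (by simp) _ (.inr hu)).2 h

end IndPath

/-! ### Holes -/

/-- A hole is a vertex `a` together with an induced path between two non-adjacent vertices that
are the only neighbours of `a` on that path. -/
theorem IndPath.isHole_insert {a b c : V} {S : Set V} (h : G.IndPath b c S) (hab : G.Adj a b)
    (hac : G.Adj a c) (hbc : b ≠ c) (hbc' : ¬ G.Adj b c) (ha : a ∉ S)
    (haS : ∀ w ∈ S, G.Adj a w → w = b ∨ w = c) : G.IsHole (insert a S) := by
  obtain ⟨p, ⟨hp, hc⟩, rfl⟩ := h.exists_walk
  have hlen : 2 ≤ p.length := by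
    by_contra hlt
    have : p.length = 0 ∨ p.length = 1 := by omega
    rcases this with h | h
    · exact hbc (Walk.eq_of_length_eq_zero h)
    · exact hbc' (Walk.adj_of_length_eq_one h)
  have hca : (p.concat hac.symm).IsPath := hp.concat ha hac.symm
  refine ⟨a, .cons hab (p.concat hac.symm), ?_, ?_, ?_, ?_⟩
  · rw [Walk.cons_isCycle_iff]
    refine ⟨hca, ?_⟩
    rw [Walk.edges_concat]
    simp only [List.concat_eq_append, List.mem_append, List.mem_singleton, not_or]
    refine ⟨fun h => ha (p.fst_mem_support_of_mem_edges h), ?_⟩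
    simp only [Sym2.eq_iff]
    grind
  · rw [Walk.isChordless_iff_forall_mem_edges] at hc ⊢
    intro u v hu hv huv
    simp only [Walk.support_cons, Walk.support_concat, List.concat_eq_append, List.mem_cons,
      List.mem_append, Walk.edges_cons, Walk.edges_concat, Sym2.eq_iff,
      List.not_mem_nil, or_false] at hu hv ⊢
    have := haS u
    have := haS v
    have := G.irrefl (v := a)
    have := huv.symm
    have := @hc u v
    simp only [Set.mem_ofPred_eq] at *
    grind
  · simp only [Walk.length_cons, Walk.length_concat]; omega
  · ext u
    simp only [Walk.support_cons, Walk.support_concat, List.mem_cons,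
      List.mem_append, Set.mem_insert_iff, Set.mem_ofPred_eq, List.not_mem_nil, or_false]
    tauto

theorem IsHole.exists_indPath {W : Set V} (hW : G.IsHole W) {a : V} (ha : a ∈ W) :
    ∃ b c S, G.IndPath b c S ∧ W = insert a S ∧ G.Adj a b ∧ G.Adj a c ∧ b ≠ c ∧ ¬ G.Adj b c ∧
      a ∉ S ∧ ∀ w ∈ S, G.Adj a w → w = b ∨ w = c := by
  classical
  obtain ⟨u, c₀, hc₀, hch₀, hlen₀, rfl⟩ := hW
  obtain ⟨c, hc, hch, hlen, hsupp⟩ : ∃ c : G.Walk a a, c.IsCycle ∧ c.IsChordless ∧ 4 ≤ c.length ∧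
      ∀ z, z ∈ c.support ↔ z ∈ c₀.support := by
    refine ⟨c₀.rotate a ha, by simpa using hc₀, ?_, by simpa using hlen₀, fun z => by simp⟩
    rw [Walk.isChordless_iff_forall_mem_edges] at hch₀ ⊢
    intro u v hu hv huv
    have := hch₀ (by simpa using hu) (by simpa using hv) huv
    exact (c₀.rotate_edges a ha).mem_iff.2 this
  cases c with
  | nil => simp at hlen
  | @cons _ b _ hab p =>
  cases p with
  | nil => simp at hlen
  | cons h p =>
  obtain ⟨c, q, hca, hq⟩ := Walk.exists_cons_eq_concat h p
  rw [hq] at hc hch hlen hsupp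
  clear hq p h
  rw [Walk.cons_isCycle_iff] at hc
  obtain ⟨hp, hne⟩ := hc
  rw [Walk.concat_isPath_iff] at hp
  obtain ⟨hp, haq⟩ := hp
  rw [Walk.isChordless_iff_forall_mem_edges] at hch
  simp only [Walk.length_cons, Walk.length_concat] at hlen
  simp only [Walk.edges_concat, List.concat_eq_append, List.mem_append, List.mem_singleton,
    not_or] at hne
  have hedge : ∀ u v, u ∈ q.support → v ∈ q.support → G.Adj u v → s(u, v) ∈ q.edges := by
    intro u v hu hv huv
    have := hch (u' := u) (v' := v) (by simp [hu, Walk.support_concat])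
      (by simp [hv, Walk.support_concat]) huv
    simp only [Walk.edges_cons, Walk.edges_concat, List.concat_eq_append, List.mem_append,
      List.mem_cons, List.not_mem_nil, or_false, Sym2.eq_iff] at this
    grind
  have hbc : b ≠ c := by
    rintro rfl
    exact hne.2 Sym2.eq_swap
  refine ⟨b, c, _, .of_walk q hp (Walk.isChordless_iff_forall_mem_edges.2 fun u v => hedge u v),
    ?_, hab, hca.symm, hbc, ?_, haq, ?_⟩
  · ext z
    simp only [Set.mem_ofPred_eq, ← hsupp, Walk.support_cons, Walk.support_concat, List.mem_cons,
      List.mem_append, Set.mem_insert_iff, List.not_mem_nil, or_false]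
    tauto
  · intro h
    have := hedge b c q.start_mem_support q.end_mem_support h
    have := hp.length_eq_one_of_mem_edges this
    omega
  · intro w hw haw
    have := hch (u' := a) (v' := w) (by simp)
      (by simp [show w ∈ q.support from hw, Walk.support_concat]) haw
    simp only [Walk.edges_cons, Walk.edges_concat, List.concat_eq_append, List.mem_append,
      List.mem_cons, List.not_mem_nil, or_false, Sym2.eq_iff] at this
    rcases this with h | h | h
    · grind
    · exact absurd (q.fst_mem_support_of_mem_edges h) haq
    · grind

theorem IndPath.isHole_union {x y : V} {S T : Set V} (hS : G.IndPath x y S) (hT : G.IndPath x y T)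
    (hxy : x ≠ y) (hxy' : ¬ G.Adj x y)
    (h : ∀ u ∈ S, ∀ w ∈ T, u ≠ x → u ≠ y → w ≠ x → w ≠ y → u ≠ w ∧ ¬ G.Adj u w) :
    G.IsHole (S ∪ T) := by
  cases hS with
  | nil => exact absurd rfl hxy
  | @cons _ s _ S e p hx hw =>
  cases hT with
  | nil => exact absurd rfl hxy
  | @cons _ t _ T e' p' hx' hw' =>
  have hsy : s ≠ y := by rintro rfl; exact hxy' e
  have hty : t ≠ y := by rintro rfl; exact hxy' e'
  have key : ∀ u ∈ S, ∀ w ∈ T, u ≠ y → w ≠ y → u ≠ w ∧ ¬ G.Adj u w := fun u hu w hw h₁ h₂ =>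
    h u (.inr hu) w (.inr hw) (fun h => hx (h ▸ hu)) h₁ (fun h => hx' (h ▸ hw)) h₂
  have : insert x S ∪ insert x T = insert x (S ∪ T) := by ext; simp; tauto
  rw [this]
  have hst := key s p.left_mem t p'.left_mem hsy hty
  refine (p.append p'.symm key).isHole_insert e e' hst.1 hst.2 (by simp [hx, hx']) ?_
  rintro w (h | h) h'
  · exact .inl (hw w h h')
  · exact .inr (hw' w h h')

/-! ### Thetas, pyramids and prisms from induced paths -/

theorem containsTheta_of_indPath {a b : V} {S : Fin 3 → Set V} (hab : a ≠ b) (hab' : ¬ G.Adj a b)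
    (hS : ∀ i, G.IndPath a b (S i))
    (h : ∀ i j, i ≠ j → ∀ x ∈ S i, ∀ z ∈ S j, x ≠ a → x ≠ b → z ≠ a → z ≠ b →
      x ≠ z ∧ ¬ G.Adj x z) : G.ContainsTheta := by
  choose P hP hPS using fun i => (hS i).exists_walk
  have key : ∀ i x, x ∈ G.pathInterior (P i) → x ∈ S i ∧ x ≠ a ∧ x ≠ b := by
    rintro i x ⟨hx, hx'⟩
    rw [hPS] at hx
    simpa [hx] using hx'
  refine ⟨a, b, P, hab', fun i => ⟨hP i, ?_⟩, fun i j hij => ⟨?_, ?_⟩⟩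
  · by_contra hlt
    have : (P i).length = 0 ∨ (P i).length = 1 := by omega
    rcases this with h | h
    · exact hab (Walk.eq_of_length_eq_zero h)
    · exact hab' (Walk.adj_of_length_eq_one h)
  · rw [Set.disjoint_left]
    intro x hx hx'
    have h₁ := key i x hx
    have h₂ := key j x hx'
    exact (h i j hij x h₁.1 x h₂.1 h₁.2.1 h₁.2.2 h₁.2.1 h₁.2.2).1 rfl
  · intro x hx z hz
    have h₁ := key i x hx
    have h₂ := key j z hz
    exact (h i j hij x h₁.1 z h₂.1 h₁.2.1 h₁.2.2 h₂.2.1 h₂.2.2).2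

theorem containsPyramid_of_indPath {a : V} {b : Fin 3 → V} {S : Fin 3 → Set V}
    (hb : ∀ i j, i ≠ j → G.Adj (b i) (b j)) (hab : ∀ i, a ≠ b i)
    (hab' : ∀ i j, i ≠ j → ¬ (G.Adj a (b i) ∧ G.Adj a (b j)))
    (hS : ∀ i, G.IndPath a (b i) (S i))
    (h : ∀ i j, i ≠ j → ∀ x ∈ S i, ∀ z ∈ S j, x ≠ a → z ≠ a →
      x ≠ z ∧ (G.Adj x z → x = b i ∧ z = b j)) : G.ContainsPyramid := by
  choose P hP hPS using fun i => (hS i).exists_walk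
  refine ⟨a, b, P, hb, fun i => ⟨hP i, ?_⟩, fun i j hij h => hab' i j hij
    ⟨Walk.adj_of_length_eq_one h.1, Walk.adj_of_length_eq_one h.2⟩,
    fun i j hij x hx z hz => h i j hij x ((hPS i).subset hx) z ((hPS j).subset hz)⟩
  by_contra hlt
  exact hab i (Walk.eq_of_length_eq_zero (p := P i) (by omega))

theorem containsPrism_of_indPath {a b : Fin 3 → V} {S : Fin 3 → Set V}
    (ha : ∀ i j, i ≠ j → G.Adj (a i) (a j)) (hb : ∀ i j, i ≠ j → G.Adj (b i) (b j))
    (hab : ∀ i, a i ≠ b i) (hS : ∀ i, G.IndPath (a i) (b i) (S i))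
    (h : ∀ i j, i ≠ j → ∀ x ∈ S i, ∀ z ∈ S j,
      x ≠ z ∧ (G.Adj x z → (x = a i ∧ z = a j) ∨ (x = b i ∧ z = b j))) : G.ContainsPrism := by
  choose P hP hPS using fun i => (hS i).exists_walk
  refine ⟨a, b, P, ha, hb, fun i => ⟨hP i, ?_⟩,
    fun i j hij x hx z hz => h i j hij x ((hPS i).subset hx) z ((hPS j).subset hz)⟩
  by_contra hlt
  exact hab i (Walk.eq_of_length_eq_zero (p := P i) (by omega))

/-! ### Connecting three vertices through a set -/

/-- Some induced path through `A` joins two of the three vertices `y i`, and `y k`, the third of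
them, has a neighbour on it. -/
def IsMiddle (G : SimpleGraph V) (A : Set V) (y : Fin 3 → V) (k : Fin 3) : Prop :=
  ∃ i j S, i ≠ j ∧ i ≠ k ∧ j ≠ k ∧ G.IndPath (y i) (y j) S ∧ S ⊆ A ∪ {y i, y j} ∧
    ∃ z ∈ S, G.Adj (y k) z

/-- A claw joining the three vertices `y i` through `A`: induced paths `L i` from a centre `a` to
the `y i`, disjoint and anticomplete apart from `a`. The centre lies in `A` or is one of
the `y k` (then `L k` is trivial); the latter is allowed only if `y k` is a middle vertex. -/
structure IsClaw (G : SimpleGraph V) (A : Set V) (y : Fin 3 → V) (a : V) (L : Fin 3 → Set V) :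
    Prop where
  center : a ∈ A ∨ ∃ k, a = y k ∧ G.IsMiddle A y k
  path : ∀ i, G.IndPath a (y i) (L i)
  subset : ∀ i, ∀ x ∈ L i, x ∈ A ∨ x = a ∨ x = y i
  sep : ∀ i j, i ≠ j → ∀ x ∈ L i, ∀ z ∈ L j, x ≠ a → z ≠ a → x ≠ z ∧ ¬ G.Adj x z

/-- A triangle joining the three vertices `y i` through `A`: disjoint induced paths `L i` from the
vertices `b i` of a triangle to the `y i`, with no edges between them but those of the triangle.
The path `L i` is trivial if `b i = y i`. -/
structure IsTri (G : SimpleGraph V) (A : Set V) (y b : Fin 3 → V) (L : Fin 3 → Set V) : Prop where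
  adj : ∀ i j, i ≠ j → G.Adj (b i) (b j)
  path : ∀ i, G.IndPath (b i) (y i) (L i)
  subset : ∀ i, ∀ x ∈ L i, x ∈ A ∨ x = y i
  sep : ∀ i j, i ≠ j → ∀ x ∈ L i, ∀ z ∈ L j, x ≠ z ∧ (G.Adj x z → x = b i ∧ z = b j)

/-- Three pairwise non-adjacent vertices `y i` outside two disjoint anticomplete sets. -/
structure TwoSided (G : SimpleGraph V) (A B : Set V) (y : Fin 3 → V) : Prop where
  sep : ∀ x ∈ A, ∀ z ∈ B, x ≠ z ∧ ¬ G.Adj x z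
  left : ∀ i, y i ∉ A
  right : ∀ i, y i ∉ B
  inj : ∀ i j, i ≠ j → y i ≠ y j
  stable : ∀ i j, ¬ G.Adj (y i) (y j)

theorem TwoSided.symm {A B : Set V} {y : Fin 3 → V} (h : G.TwoSided A B y) : G.TwoSided B A y :=
  ⟨fun x hx z hz => ⟨(h.sep z hz x hx).1.symm, fun e => (h.sep z hz x hx).2 e.symm⟩,
    h.right, h.left, h.inj, h.stable⟩

theorem fin_three_others (k : Fin 3) : ∃ i j, i ≠ j ∧ i ≠ k ∧ j ≠ k := by
  fin_cases k
  · exact ⟨1, 2, by decide⟩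
  · exact ⟨0, 2, by decide⟩
  · exact ⟨0, 1, by decide⟩

theorem IsClaw.isMiddle {A : Set V} {y : Fin 3 → V} {a : V} {L : Fin 3 → Set V}
    (h : G.IsClaw A y a L) (ha : a ∈ A) {k : Fin 3} (hk : G.Adj a (y k)) : G.IsMiddle A y k := by
  obtain ⟨i, j, hij, hik, hjk⟩ := fin_three_others k
  refine ⟨i, j, L i ∪ L j, hij, hik, hjk, (h.path i).symm.append (h.path j) (h.sep i j hij), ?_,
    a, .inl (h.path i).left_mem, hk.symm⟩
  have hi := h.subset i
  have hj := h.subset j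
  rintro x (hx | hx) <;> simp only [Set.mem_union, Set.mem_insert_iff, Set.mem_singleton_iff] <;>
    grind

theorem IsTri.isMiddle {A : Set V} {y b : Fin 3 → V} {L : Fin 3 → Set V}
    (h : G.IsTri A y b L) {k : Fin 3} (hk : b k = y k) : G.IsMiddle A y k := by
  obtain ⟨i, j, hij, hik, hjk⟩ := fin_three_others k
  have hp : G.IndPath (b i) (y j) (insert (b i) (L j)) :=
    .cons (h.adj i j hij) (h.path j) (fun hb => (h.sep i j hij _ (h.path i).left_mem _ hb).1 rfl)
      fun w hw hbw => ((h.sep i j hij _ (h.path i).left_mem _ hw).2 hbw).2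
  refine ⟨i, j, L i ∪ insert (b i) (L j), hij, hik, hjk, (h.path i).symm.append hp ?_, ?_,
    b i, by simp, hk ▸ h.adj k i hik.symm⟩
  · rintro u hu w (rfl | hw) hu' hw'
    · exact absurd rfl hw'
    · have := h.sep i j hij u hu w hw
      exact ⟨this.1, fun e => hu' (this.2 e).1⟩
  have hi := h.subset i
  have hj := h.subset j
  have := (h.path i).left_mem
  rintro x (hx | hx | hx) <;>
    simp only [Set.mem_union, Set.mem_insert_iff, Set.mem_singleton_iff] <;> grind

/-! ### Combining the two sides -/

/-- Legs that end in the same `y i` combine to the three paths of a theta. -/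
theorem IsClaw.containsTheta_of_centers {A B : Set V} {y : Fin 3 → V} (hAB : G.TwoSided A B y)
    {a b : V} {L M : Fin 3 → Set V} (hA : G.IsClaw A y a L) (hB : G.IsClaw B y b M)
    (hab : a ≠ b) (hab' : ¬ G.Adj a b) : G.ContainsTheta := by
  refine containsTheta_of_indPath (S := fun i => L i ∪ M i) hab hab'
    (fun i => (hA.path i).append (hB.path i).symm ?_) ?_
  · intro u hu w hw hu' hw'
    by_cases hua : u = a
    · by_cases hwb : w = b
      · exact hua ▸ hwb ▸ ⟨hab, hab'⟩
      · have hwB := ((hB.subset i w hw).resolve_right (by tauto))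
        subst hua
        rcases hA.center with ha | ⟨l, rfl, -⟩
        · exact hAB.sep u ha w hwB
        · exact hB.sep l i (fun h => hu' (h ▸ rfl)) _ (hB.path l).right_mem w hw hab hwb
    · have huA := ((hA.subset i u hu).resolve_right (by tauto))
      rcases hB.subset i w hw with hw₁ | rfl | rfl
      · exact hAB.sep u huA w hw₁
      · rcases hB.center with hb | ⟨l, rfl, -⟩
        · exact hAB.sep u huA w hb
        · exact hA.sep i l (fun h => hw' (h ▸ rfl)) u hu _ (hA.path l).right_mem hua hab.symm
      · exact absurd rfl hw'
  · have key : ∀ i j, i ≠ j → ∀ x ∈ L i, ∀ z ∈ M j, x ≠ a → x ≠ b → z ≠ a → z ≠ b →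
        x ≠ z ∧ ¬ G.Adj x z := by
      intro i j hij x hx z hz h₁ h₂ h₃ h₄
      rcases hA.subset i x hx with hx' | rfl | rfl
      · rcases hB.subset j z hz with hz' | rfl | rfl
        · exact hAB.sep x hx' z hz'
        · exact absurd rfl h₄
        · exact hA.sep i j hij x hx _ (hA.path j).right_mem h₁ h₃
      · exact absurd rfl h₁
      · exact hB.sep i j hij _ (hB.path i).right_mem z hz h₂ h₄
    rintro i j hij x (hx | hx) z (hz | hz) h₁ h₂ h₃ h₄
    · exact hA.sep i j hij x hx z hz h₁ h₃
    · exact key i j hij x hx z hz h₁ h₂ h₃ h₄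
    · have := key j i hij.symm z hz x hx h₃ h₄ h₁ h₂
      exact ⟨this.1.symm, fun e => this.2 e.symm⟩
    · exact hB.sep i j hij x hx z hz h₂ h₄

section Combine

variable {A B : Set V} {y : Fin 3 → V} (hAB : G.TwoSided A B y)
  (hM : ∀ k, ¬ (G.IsMiddle A y k ∧ G.IsMiddle B y k))
include hAB hM

/-- The centres of the two claws are distinct and non-adjacent unless some `y k` is a middle vertex
on both sides. -/
theorem IsClaw.containsTheta {a b : V} {L M : Fin 3 → Set V} (hA : G.IsClaw A y a L)
    (hB : G.IsClaw B y b M) : G.ContainsTheta := by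
  have hab : a ≠ b := by
    rintro rfl
    rcases hA.center with ha | ⟨k, rfl, hk⟩
    · rcases hB.center with hb | ⟨l, rfl, hl⟩
      · exact (hAB.sep a ha a hb).1 rfl
      · exact hAB.left l ha
    · rcases hB.center with hb | ⟨l, hkl, hl⟩
      · exact hAB.right k hb
      · by_cases h : k = l
        · exact hM k ⟨hk, h ▸ hl⟩
        · exact hAB.inj k l h hkl
  have hab' : ¬ G.Adj a b := by
    intro e
    rcases hA.center with ha | ⟨k, rfl, hk⟩
    · rcases hB.center with hb | ⟨l, rfl, hl⟩
      · exact (hAB.sep a ha b hb).2 e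
      · exact hM l ⟨hA.isMiddle ha e, hl⟩
    · rcases hB.center with hb | ⟨l, rfl, hl⟩
      · exact hM k ⟨hk, hB.isMiddle hb e.symm⟩
      · exact hAB.stable k l e
  exact hA.containsTheta_of_centers hAB hB hab hab'

theorem IsClaw.containsPyramid {a : V} {b : Fin 3 → V} {L M : Fin 3 → Set V} (hA : G.IsClaw A y a L)
    (hB : G.IsTri B y b M) : G.ContainsPyramid := by
  have hb : ∀ i, b i ∈ B ∨ b i = y i := fun i => hB.subset i _ (hB.path i).left_mem
  -- a centre among the `y k` has no edge to the other legs of the triangle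
  have hctr : ∀ k, a = y k → G.IsMiddle A y k → ∀ i, i ≠ k → ∀ w ∈ M i, a ≠ w ∧ ¬ G.Adj a w := by
    rintro k rfl hk i hik w hw
    have := hB.sep k i hik.symm _ (hB.path k).right_mem w hw
    exact ⟨this.1, fun e => hM k ⟨hk, hB.isMiddle (this.2 e).1.symm⟩⟩
  have hab : ∀ i, a ≠ b i := by
    rintro i h
    rcases hA.center with ha | ⟨k, hk, hk'⟩
    · rcases hb i with h' | h'
      · exact (hAB.sep a ha _ h').1 h
      · exact hAB.left i (h' ▸ h ▸ ha)
    · by_cases hik : i = k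
      · subst hik
        exact hM i ⟨hk', hB.isMiddle (h ▸ hk)⟩
      · exact (hctr k hk hk' i hik _ (hB.path i).left_mem).1 h
  refine containsPyramid_of_indPath (S := fun i => L i ∪ M i) hB.adj hab ?_
    (fun i => (hA.path i).append (hB.path i).symm ?_) ?_
  · rintro i j hij ⟨hi, hj⟩
    rcases hA.center with ha | ⟨k, hk, hk'⟩
    · have hi' := (hb i).resolve_left fun h => (hAB.sep a ha _ h).2 hi
      have hj' := (hb j).resolve_left fun h => (hAB.sep a ha _ h).2 hj
      exact hAB.stable i j (hi' ▸ hj' ▸ hB.adj i j hij)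
    · by_cases hik : i = k
      · exact (hctr k hk hk' j (hik ▸ hij.symm) _ (hB.path j).left_mem).2 hj
      · exact (hctr k hk hk' i hik _ (hB.path i).left_mem).2 hi
  · intro u hu w hw hu' hw'
    have hwB := (hB.subset i w hw).resolve_right hw'
    rcases hA.subset i u hu with hu | rfl | rfl
    · exact hAB.sep u hu w hwB
    · rcases hA.center with ha | ⟨k, hk, hk'⟩
      · exact hAB.sep u ha w hwB
      · exact hctr k hk hk' i (fun h => hu' (h ▸ hk)) w hw
    · exact absurd rfl hu'
  · have key : ∀ i j, i ≠ j → ∀ x ∈ L i, ∀ z ∈ M j, x ≠ a → z ≠ a →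
        x ≠ z ∧ (G.Adj x z → x = b i ∧ z = b j) := by
      intro i j hij x hx z hz h₁ h₂
      rcases hA.subset i x hx with hx' | rfl | rfl
      · rcases hB.subset j z hz with hz' | rfl
        · exact ⟨(hAB.sep x hx' z hz').1, fun e => absurd e (hAB.sep x hx' z hz').2⟩
        · have := hA.sep i j hij x hx _ (hA.path j).right_mem h₁ h₂
          exact ⟨this.1, fun e => absurd e this.2⟩
      · exact absurd rfl h₁
      · exact hB.sep i j hij _ (hB.path i).right_mem z hz
    rintro i j hij x (hx | hx) z (hz | hz) h₁ h₂
    · have := hA.sep i j hij x hx z hz h₁ h₂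
      exact ⟨this.1, fun e => absurd e this.2⟩
    · exact key i j hij x hx z hz h₁ h₂
    · have := key j i hij.symm z hz x hx h₂ h₁
      exact ⟨this.1.symm, fun e => (this.2 e.symm).symm⟩
    · exact hB.sep i j hij x hx z hz

theorem IsTri.containsPrism {a b : Fin 3 → V} {L M : Fin 3 → Set V} (hA : G.IsTri A y a L)
    (hB : G.IsTri B y b M) : G.ContainsPrism := by
  have hab : ∀ i, a i ≠ b i := by
    intro i h
    have : a i = y i := by
      rcases hA.subset i _ (hA.path i).left_mem with h₁ | h₁
      · rcases hB.subset i _ (hB.path i).left_mem with h₂ | h₂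
        · exact absurd h (hAB.sep _ h₁ _ h₂).1
        · exact h.trans h₂
      · exact h₁
    exact hM i ⟨hA.isMiddle this, hB.isMiddle (h ▸ this)⟩
  refine containsPrism_of_indPath (S := fun i => L i ∪ M i) hA.adj hB.adj hab
    (fun i => (hA.path i).append (hB.path i).symm ?_) ?_
  · intro u hu w hw hu' hw'
    exact hAB.sep u ((hA.subset i u hu).resolve_right hu') w ((hB.subset i w hw).resolve_right hw')
  · have key : ∀ i j, i ≠ j → ∀ x ∈ L i, ∀ z ∈ M j,
        x ≠ z ∧ (G.Adj x z → (x = a i ∧ z = a j) ∨ (x = b i ∧ z = b j)) := by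
      intro i j hij x hx z hz
      rcases hA.subset i x hx with hx' | rfl
      · rcases hB.subset j z hz with hz' | rfl
        · exact ⟨(hAB.sep x hx' z hz').1, fun e => absurd e (hAB.sep x hx' z hz').2⟩
        · have := hA.sep i j hij x hx _ (hA.path j).right_mem
          exact ⟨this.1, fun e => .inl (this.2 e)⟩
      · have := hB.sep i j hij _ (hB.path i).right_mem z hz
        exact ⟨this.1, fun e => .inr (this.2 e)⟩
    rintro i j hij x (hx | hx) z (hz | hz)
    · have := hA.sep i j hij x hx z hz
      exact ⟨this.1, fun e => .inl (this.2 e)⟩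
    · exact key i j hij x hx z hz
    · have := key j i hij.symm z hz x hx
      exact ⟨this.1.symm, fun e => (this.2 e.symm).imp And.symm And.symm⟩
    · have := hB.sep i j hij x hx z hz
      exact ⟨this.1, fun e => .inr (this.2 e)⟩

end Combine

/-! ### Existence of claws and triangles -/

theorem fin_three_cases {i j k : Fin 3} (hij : i ≠ j) (hik : i ≠ k) (hjk : j ≠ k) (l : Fin 3) :
    l = i ∨ l = j ∨ l = k := by
  omega

theorem exists_isClaw_of_legs {A : Set V} {y : Fin 3 → V} {i j k : Fin 3} (hij : i ≠ j)
    (hik : i ≠ k) (hjk : j ≠ k) {a : V} {S T R : Set V}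
    (ha : a ∈ A ∨ ∃ k, a = y k ∧ G.IsMiddle A y k)
    (hS : G.IndPath a (y i) S) (hT : G.IndPath a (y j) T) (hR : G.IndPath a (y k) R)
    (hSA : ∀ x ∈ S, x ∈ A ∨ x = a ∨ x = y i) (hTA : ∀ x ∈ T, x ∈ A ∨ x = a ∨ x = y j)
    (hRA : ∀ x ∈ R, x ∈ A ∨ x = a ∨ x = y k)
    (hST : G.SepAt S T a) (hSR : G.SepAt S R a) (hTR : G.SepAt T R a) :
    ∃ L, G.IsClaw A y a L := by
  classical
  refine ⟨fun l => if l = i then S else if l = j then T else R, ha, ?_, ?_, ?_⟩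
  · intro l
    rcases fin_three_cases hij hik hjk l with rfl | rfl | rfl <;>
      simp [*, hij.symm, hik.symm, hjk.symm]
  · intro l
    rcases fin_three_cases hij hik hjk l with rfl | rfl | rfl <;>
      simpa [hij.symm, hik.symm, hjk.symm]
  · intro l m hlm
    rcases fin_three_cases hij hik hjk l with rfl | rfl | rfl <;>
      rcases fin_three_cases hij hik hjk m with rfl | rfl | rfl <;>
      simp only [↓reduceIte, hij.symm, hik.symm, hjk.symm] <;>
      first
      | exact absurd rfl hlm
      | assumption
      | exact hST.symm
      | exact hSR.symm
      | exact hTR.symm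

theorem exists_isTri_of_legs {A : Set V} {y : Fin 3 → V} {i j k : Fin 3} (hij : i ≠ j)
    (hik : i ≠ k) (hjk : j ≠ k) {p q r : V} {S T R : Set V}
    (hpq : G.Adj p q) (hpr : G.Adj p r) (hqr : G.Adj q r)
    (hS : G.IndPath p (y i) S) (hT : G.IndPath q (y j) T) (hR : G.IndPath r (y k) R)
    (hSA : ∀ x ∈ S, x ∈ A ∨ x = y i) (hTA : ∀ x ∈ T, x ∈ A ∨ x = y j)
    (hRA : ∀ x ∈ R, x ∈ A ∨ x = y k)
    (hST : ∀ x ∈ S, ∀ z ∈ T, x ≠ z ∧ (G.Adj x z → x = p ∧ z = q))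
    (hSR : ∀ x ∈ S, ∀ z ∈ R, x ≠ z ∧ (G.Adj x z → x = p ∧ z = r))
    (hTR : ∀ x ∈ T, ∀ z ∈ R, x ≠ z ∧ (G.Adj x z → x = q ∧ z = r)) :
    ∃ b L, G.IsTri A y b L := by
  classical
  refine ⟨fun l => if l = i then p else if l = j then q else r,
    fun l => if l = i then S else if l = j then T else R, ?_, ?_, ?_, ?_⟩
  · intro l m hlm
    rcases fin_three_cases hij hik hjk l with rfl | rfl | rfl <;>
      rcases fin_three_cases hij hik hjk m with rfl | rfl | rfl <;>
      simp only [↓reduceIte, hij.symm, hik.symm, hjk.symm] <;>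
      first
      | exact absurd rfl hlm
      | assumption
      | exact G.adj_symm (by assumption)
  · intro l
    rcases fin_three_cases hij hik hjk l with rfl | rfl | rfl <;>
      simp [*, hij.symm, hik.symm, hjk.symm]
  · intro l
    rcases fin_three_cases hij hik hjk l with rfl | rfl | rfl <;>
      simpa [hij.symm, hik.symm, hjk.symm]
  · have swap : ∀ {S T : Set V} {p q : V},
        (∀ x ∈ S, ∀ z ∈ T, x ≠ z ∧ (G.Adj x z → x = p ∧ z = q)) →
        ∀ x ∈ T, ∀ z ∈ S, x ≠ z ∧ (G.Adj x z → x = q ∧ z = p) := fun h x hx z hz =>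
      ⟨(h z hz x hx).1.symm, fun e => ((h z hz x hx).2 e.symm).symm⟩
    intro l m hlm
    rcases fin_three_cases hij hik hjk l with rfl | rfl | rfl <;>
      rcases fin_three_cases hij hik hjk m with rfl | rfl | rfl <;>
      simp only [↓reduceIte, hij.symm, hik.symm, hjk.symm] <;>
      first
      | exact absurd rfl hlm
      | assumption
      | exact swap hST
      | exact swap hSR
      | exact swap hTR

section Attach

variable {A : Set V} {y : Fin 3 → V} {i j k : Fin 3} (hij : i ≠ j) (hik : i ≠ k) (hjk : j ≠ k)
  {S : Set V} (hS : G.IndPath (y i) (y j) S) (hSA : ∀ x ∈ S, x ∈ A ∨ x = y i ∨ x = y j)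
  {r : V} {R : Set V} (hR : G.IndPath r (y k) R) (hRA : ∀ x ∈ R, x ∈ A ∨ x = y k)
  (hRS : ∀ u ∈ R, ∀ w ∈ S, u ≠ w ∧ (G.Adj u w → u = r))
include hij hik hjk hS hSA hR hRA hRS

/-- If the path `R` is attached to the path `S` at a single vertex `p` of `S`, then `p` is the
centre of a claw. -/
theorem exists_isClaw_of_unique {p : V} (hp : p ∈ S) (hpA : p ∈ A) (hrp : G.Adj r p)
    (huniq : ∀ w ∈ S, G.Adj r w → w = p) : ∃ L, G.IsClaw A y p L := by
  obtain ⟨S₁, S₂, h₁, h₂, rfl, hsep⟩ := hS.exists_split hp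
  have hpR : G.IndPath p (y k) (insert p R) := .cons hrp.symm hR
    (fun h => (hRS p h p hp).1 rfl) fun w hw e => (hRS w hw p hp).2 e.symm
  have key : ∀ T ⊆ S₁ ∪ S₂, G.SepAt T (insert p R) p := by
    rintro T hT u hu w (rfl | hw) hu' hw'
    · exact absurd rfl hw'
    · refine ⟨(hRS w hw u (hT hu)).1.symm, fun e => hu' (huniq u (hT hu) ?_)⟩
      exact (hRS w hw u (hT hu)).2 e.symm ▸ e.symm
  have hne : ∀ l, y l ∈ S₁ → y l ∈ S₂ → y l = p := fun l h h' => by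
    by_contra hlp
    exact (hsep _ h _ h' hlp hlp).1 rfl
  refine exists_isClaw_of_legs hij hik hjk (.inl hpA) h₁.symm h₂ hpR ?_ ?_ ?_ hsep
    (key _ Set.subset_union_left) (key _ Set.subset_union_right)
  · intro x hx
    rcases hSA x (.inl hx) with h | rfl | rfl
    · exact .inl h
    · exact .inr (.inr rfl)
    · exact .inr (.inl (hne j hx h₂.right_mem))
  · intro x hx
    rcases hSA x (.inr hx) with h | rfl | rfl
    · exact .inl h
    · exact .inr (.inl (hne i h₁.left_mem hx))
    · exact .inr (.inr rfl)
  · rintro x (rfl | hx)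
    · exact .inr (.inl rfl)
    · exact (hRA x hx).imp_right .inr

/-- A path `R` from `y k`, attached by its other end `r` to a path `S` between the other
two vertices, yields a claw centred at the only neighbour of `r` on `S`, a triangle formed by `r`
and its two adjacent neighbours on `S`, or a claw centred at `r` whose legs start at the first and the
last neighbour of `r` on `S`. -/
theorem exists_isClaw_or_isTri_of_attach (hr : ∃ w ∈ S, w ∈ A ∧ G.Adj r w) :
    (∃ a L, G.IsClaw A y a L) ∨ ∃ b L, G.IsTri A y b L := by
  obtain ⟨w, hw, hwA, hrw⟩ := hr
  obtain ⟨p, hp, q, hq, S₁, S₂, S₃, h₁, h₂, h₃, hSeq, hsep₁, hsep₃, hf₁, hf₃⟩ :=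
    hS.exists_first_last (N := G.neighborSet r) ⟨w, hw, hrw⟩
  rw [mem_neighborSet] at hp hq
  by_cases hpq : p = q
  · subst hpq
    have huniq : ∀ w ∈ S, G.Adj r w → w = p := by
      intro w hw hrw
      rw [hSeq, h₂.eq_singleton] at hw
      rcases hw with (hw | hw) | hw
      · exact hf₁ w hw hrw
      · exact hw
      · exact hf₃ w hw hrw
    obtain rfl := huniq w hw hrw
    exact .inl ⟨w, exists_isClaw_of_unique hij hik hjk hS hSA hR hRA hRS hw hwA hrw huniq⟩
  have h13 : ∀ x ∈ S₁, ∀ z ∈ S₃, x ≠ z ∧ (G.Adj x z → x = p ∧ z = q) := by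
    intro x hx z hz
    by_cases hxp : x = p
    · subst hxp
      by_cases hzq : z = q
      · exact ⟨hzq ▸ hpq, fun _ => ⟨rfl, hzq⟩⟩
      · have := hsep₃ x (.inl hx) z hz hpq hzq
        exact ⟨this.1, fun e => absurd e this.2⟩
    · have hzp : z ≠ p := by rintro rfl; exact hpq (hf₃ z hz hp)
      have := hsep₁ x hx z (.inr hz) hxp hzp
      exact ⟨this.1, fun e => absurd e this.2⟩
  have hS₁ : S₁ ⊆ S := by rw [hSeq]; exact fun x hx => .inl (.inl hx)
  have hS₃ : S₃ ⊆ S := by rw [hSeq]; exact fun x hx => .inr hx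
  have h1A : ∀ x ∈ S₁, x ∈ A ∨ x = y i := fun x hx => by
    rcases hSA x (hS₁ hx) with h | h | rfl
    · exact .inl h
    · exact .inr h
    · exact absurd rfl (h13 _ hx _ h₃.right_mem).1
  have h3A : ∀ x ∈ S₃, x ∈ A ∨ x = y j := fun x hx => by
    rcases hSA x (hS₃ hx) with h | rfl | h
    · exact .inl h
    · exact absurd rfl (h13 _ h₁.left_mem _ hx).1
    · exact .inr h
  by_cases hpq' : G.Adj p q
  · refine .inr (exists_isTri_of_legs hij hik hjk hpq' hp.symm hq.symm h₁.symm h₃ hR h1A h3A hRA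
      h13 ?_ ?_)
    · intro x hx z hz
      refine ⟨(hRS z hz x (hS₁ hx)).1.symm, fun e => ?_⟩
      obtain rfl := (hRS z hz x (hS₁ hx)).2 e.symm
      exact ⟨hf₁ x hx e.symm, rfl⟩
    · intro x hx z hz
      refine ⟨(hRS z hz x (hS₃ hx)).1.symm, fun e => ?_⟩
      obtain rfl := (hRS z hz x (hS₃ hx)).2 e.symm
      exact ⟨hf₃ x hx e.symm, rfl⟩
  · have hrS : r ∉ S := fun h => (hRS r hR.left_mem r h).1 rfl
    have key : ∀ T ⊆ S, G.SepAt (insert r T) R r := by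
      rintro T hT u (rfl | hu) w hw hu' hw'
      · exact absurd rfl hu'
      · exact ⟨(hRS w hw u (hT hu)).1.symm, fun e => hw' ((hRS w hw u (hT hu)).2 e.symm)⟩
    refine .inl ⟨r, exists_isClaw_of_legs hij hik hjk ?_
      (.cons hp h₁.symm (fun h => hrS (hS₁ h)) hf₁) (.cons hq h₃ (fun h => hrS (hS₃ h)) hf₃) hR
      ?_ ?_ (fun x hx => (hRA x hx).imp_right .inr) ?_ (key _ hS₁) (key _ hS₃)⟩
    · rcases hRA r hR.left_mem with h | h
      · exact .inl h
      · exact .inr ⟨k, h, i, j, S, hij, hik, hjk, hS, hSA, w, hw, h ▸ hrw⟩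
    · rintro x (rfl | hx)
      · exact .inr (.inl rfl)
      · exact (h1A x hx).imp_right .inr
    · rintro x (rfl | hx)
      · exact .inr (.inl rfl)
      · exact (h3A x hx).imp_right .inr
    · rintro x (rfl | hx) z (rfl | hz) hx' hz'
      · exact absurd rfl hx'
      · exact absurd rfl hx'
      · exact absurd rfl hz'
      · have := h13 x hx z hz
        exact ⟨this.1, fun e => hpq' ((this.2 e).1 ▸ (this.2 e).2 ▸ e)⟩

end Attach

theorem IsMiddle.exists_isClaw_or_isTri {A : Set V} {y : Fin 3 → V} {k : Fin 3}
    (h : G.IsMiddle A y k) (hA : ∀ i, y i ∉ A) (hinj : ∀ i j, i ≠ j → y i ≠ y j)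
    (hst : ∀ i j, ¬ G.Adj (y i) (y j)) :
    (∃ a L, G.IsClaw A y a L) ∨ ∃ b L, G.IsTri A y b L := by
  obtain ⟨i, j, S, hij, hik, hjk, hS, hSA, z, hz, hkz⟩ := h
  refine exists_isClaw_or_isTri_of_attach hij hik hjk hS hSA (.nil (y k)) (fun x hx => .inr hx) ?_
    ⟨z, hz, ?_, hkz⟩
  · rintro u rfl w hw
    refine ⟨?_, fun _ => rfl⟩
    rintro rfl
    rcases @hSA _ hw with h | h | h
    · exact hA k h
    · exact hinj _ _ hik h.symm
    · exact hinj _ _ hjk h.symm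
  · rcases @hSA z hz with h | rfl | rfl
    · exact h
    · exact absurd hkz (hst k i)
    · exact absurd hkz (hst k j)

/-- Any two vertices of `A` are joined by a walk in `A`. -/
def ConnectedIn (G : SimpleGraph V) (A : Set V) : Prop :=
  ∀ u ∈ A, ∀ v ∈ A, ∃ p : G.Walk u v, ∀ z ∈ p.support, z ∈ A

theorem ConnectedIn.exists_indPath {A : Set V} (hA : G.ConnectedIn A) {x y : V}
    (hx : ∃ u ∈ A, G.Adj x u) (hy : ∃ u ∈ A, G.Adj y u) :
    ∃ S ⊆ A ∪ {x, y}, G.IndPath x y S := by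
  obtain ⟨u, hu, hxu⟩ := hx
  obtain ⟨v, hv, hyv⟩ := hy
  obtain ⟨p, hp⟩ := hA u hu v hv
  refine IndPath.exists_of_walk (.cons hxu (p.concat hyv.symm)) fun z hz => ?_
  simp only [Walk.support_cons, Walk.support_concat, List.mem_cons, List.mem_append,
    List.not_mem_nil, or_false] at hz
  rcases hz with rfl | hz | rfl
  · simp
  · exact .inl (hp z hz)
  · simp

/-- A connected set attached to three pairwise non-adjacent vertices contains a claw or a triangle
joining them. -/
theorem ConnectedIn.exists_isClaw_or_isTri {A : Set V} (hA : G.ConnectedIn A) {y : Fin 3 → V}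
    (hyA : ∀ i, y i ∉ A) (hinj : ∀ i j, i ≠ j → y i ≠ y j)
    (hst : ∀ i j, ¬ G.Adj (y i) (y j)) (hN : ∀ i, ∃ u ∈ A, G.Adj (y i) u) :
    (∃ a L, G.IsClaw A y a L) ∨ ∃ b L, G.IsTri A y b L := by
  by_cases hM : ∃ k, G.IsMiddle A y k
  · obtain ⟨k, hk⟩ := hM
    exact hk.exists_isClaw_or_isTri hyA hinj hst
  push Not at hM
  obtain ⟨S, hSA, hS⟩ := hA.exists_indPath (hN 0) (hN 1)
  replace hSA : ∀ x ∈ S, x ∈ A ∨ x = y 0 ∨ x = y 1 := fun x hx => hSA hx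
  obtain ⟨s, hs, hsA⟩ : ∃ s ∈ S, s ∈ A := by
    obtain ⟨z, hz, e⟩ := hS.exists_adj_left (hinj 0 1 (by decide))
    rcases hSA z hz with h | rfl | rfl
    · exact ⟨z, hz, h⟩
    · exact absurd e (hst _ _)
    · exact absurd e (hst _ _)
  -- `R` leads from `y 2` through `A` to the first vertex next to the interior of `S`
  obtain ⟨r, R, hR, hRA, hrN, hRfst⟩ : ∃ r R, G.IndPath (y 2) r R ∧ (∀ x ∈ R, x ∈ A ∨ x = y 2) ∧
      (∃ w ∈ S, w ∈ A ∧ G.Adj r w) ∧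
      ∀ u ∈ R, ∀ w ∈ S, w ∈ A → u ≠ w ∧ (G.Adj u w → u = r) := by
    obtain ⟨u, hu, h2u⟩ := hN 2
    obtain ⟨p, hp⟩ := hA u hu s hsA
    obtain ⟨T, hTA, hT⟩ := IndPath.exists_of_walk (A := A ∪ {y 2}) (.cons h2u p) (by
      intro z hz
      rw [Walk.support_cons, List.mem_cons] at hz
      rcases hz with rfl | hz
      · simp
      · exact .inl (hp z hz))
    obtain ⟨r, hr, R, R', hR, -, rfl, -, hf⟩ :=
      hT.exists_first (N := {v | ∃ w ∈ S, w ∈ A ∧ (v = w ∨ G.Adj v w)})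
        ⟨s, hT.right_mem, s, hs, hsA, .inl rfl⟩
    have hRA : ∀ x ∈ R, x ∈ A ∨ x = y 2 := fun x hx => hTA (.inl hx)
    have hr' : ∀ w ∈ S, w ∈ A → r ≠ w := by
      rintro w hw hwA rfl
      obtain ⟨z, hz, e⟩ := hR.symm.exists_adj_left (fun h => hyA 2 (h ▸ hwA))
      exact e.ne (hf z hz ⟨r, hw, hwA, .inr e.symm⟩).symm
    refine ⟨r, R, hR, hRA, ?_, ?_⟩
    · obtain ⟨w, hw, hwA, rfl | h⟩ := hr
      · exact absurd rfl (hr' _ hw hwA)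
      · exact ⟨w, hw, hwA, h⟩
    · intro u hu w hw hwA
      refine ⟨?_, fun e => hf u hu ⟨w, hw, hwA, .inr e⟩⟩
      rintro rfl
      exact hr' u hw hwA (hf u hu ⟨u, hw, hwA, .inl rfl⟩).symm
  have hRy : ∀ i, i ≠ 2 → y i ∉ R := fun i hi h => by
    rcases hRA _ h with h | h
    · exact hyA i h
    · exact hinj i 2 hi h
  by_cases hc : ∀ u ∈ R, G.Adj u (y 0) ∨ G.Adj u (y 1) → u = r
  · refine exists_isClaw_or_isTri_of_attach (i := 0) (j := 1) (k := 2) (by decide) (by decide)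
      (by decide) hS hSA hR.symm hRA ?_ hrN
    intro u hu w hw
    rcases hSA w hw with hwA | rfl | rfl
    · exact hRfst u hu w hw hwA
    · exact ⟨fun h => hRy 0 (by decide) (h ▸ hu), fun e => hc u hu (.inl e)⟩
    · exact ⟨fun h => hRy 1 (by decide) (h ▸ hu), fun e => hc u hu (.inr e)⟩
  · exfalso
    push Not at hc
    obtain ⟨u₀, hu₀, hu₀', hu₀r⟩ := hc
    obtain ⟨r', hr', R₁, R₂, hR₁, hR₂, rfl, hsep, hf⟩ :=
      hR.exists_first (N := {v | G.Adj v (y 0) ∨ G.Adj v (y 1)}) ⟨u₀, hu₀, hu₀'⟩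
    have hrr' : r ≠ r' := by
      rintro rfl
      rw [hR₂.eq_singleton] at hu₀
      rcases hu₀ with h | h
      · exact hu₀r (hf _ h hu₀')
      · exact hu₀r h
    have hrR₁ : r ∉ R₁ := fun h => (hsep r h r hR₂.right_mem hrr' hrr').1 rfl
    obtain ⟨w, hw, hwA, hrw⟩ := hrN
    -- a path from `y 2` that leaves `R` for the other end of `S` passes through `r'`
    have key : ∀ m n, m ≠ n → m ≠ 2 → n ≠ 2 → (∀ x ∈ S, x ∈ A ∨ x = y m ∨ x = y n) →
        G.IndPath (y m) (y n) S → (∀ v ∈ R₁, G.Adj v (y n) → v = r') → G.Adj r' (y m) → False := by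
      intro m n hmn hm hn hSA hS hfn hr'm
      obtain ⟨S₁, S₂, hS₁, hS₂, rfl, hsepS⟩ := hS.exists_split hw
      have hmS₂ : y m ∉ S₂ := fun h => by
        have hmw : y m ≠ w := fun h => hyA m (h ▸ hwA)
        exact (hsepS _ hS₁.left_mem _ h hmw hmw).1 rfl
      obtain ⟨p, -, hp⟩ := hR₂.exists_walk
      obtain ⟨q, -, hq⟩ := hS₂.exists_walk
      obtain ⟨U, hU, hUp⟩ := IndPath.exists_of_walk (A := R₂ ∪ S₂) (p.append (.cons hrw q)) (by
        intro z hz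
        rw [Walk.mem_support_append_iff, Walk.support_cons, List.mem_cons] at hz
        rcases hz with hz | rfl | hz
        · exact .inl (hp.subset hz)
        · exact .inl hR₂.right_mem
        · exact .inr (hq.subset hz))
      have hsepU : G.SepAt R₁ U r' := by
        intro u hu v hv hur hvr
        rcases hU hv with hv | hv
        · exact hsep u hu v hv hur hvr
        · rcases hSA v (.inr hv) with hvA | rfl | rfl
          · have := hRfst u (.inl hu) v (.inr hv) hvA
            exact ⟨this.1, fun e => hrR₁ (this.2 e ▸ hu)⟩
          · exact absurd hv hmS₂
          · exact ⟨fun h => hRy n hn (.inl (h ▸ hu)), fun e => hur (hfn u hu e)⟩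
      refine hM m ⟨2, n, R₁ ∪ U, hn.symm, hm.symm, hmn.symm, hR₁.append hUp hsepU, ?_, r',
        .inl hR₁.right_mem, hr'm.symm⟩
      rintro x (hx | hx)
      · rcases hRA x (.inl hx) with h | rfl <;> simp [*]
      · rcases hU hx with hx | hx
        · rcases hRA x (.inr hx) with h | rfl <;> simp [*]
        · rcases hSA x (.inr hx) with h | rfl | rfl
          · simp [*]
          · exact absurd hx hmS₂
          · simp
    rcases hr' with h | h
    · exact key 0 1 (by decide) (by decide) (by decide) hSA hS (fun v hv e => hf v hv (.inr e)) h
    · exact key 1 0 (by decide) (by decide) (by decide) (fun x hx => (hSA x hx).imp_right Or.symm)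
        hS.symm (fun v hv e => hf v hv (.inl e)) h

/-! ### Hubs -/

theorem IndPath.isLongSector {W S : Set V} {v x y : V} (h : G.IndPath x y S) (hW : S ⊆ W)
    (hx : G.Adj v x) (hy : G.Adj v y) (hS : ∀ u ∈ S, G.Adj v u → u = x ∨ u = y)
    (hne : ∃ z ∈ S, ¬ G.Adj v z) : G.IsLongSector W v S := by
  obtain ⟨z, hz, hvz⟩ := hne
  have hzx : z ≠ x := by rintro rfl; exact hvz hx
  have hzy : z ≠ y := by rintro rfl; exact hvz hy
  obtain ⟨p, hp, hpS⟩ := h.exists_walk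
  refine ⟨x, y, p, hp, ?_, hpS, hW, hx, hy, ?_, z, hpS.superset hz, by simp [hzx, hzy]⟩
  · by_contra hlt
    obtain rfl := Walk.eq_of_length_eq_zero (p := p) (by omega)
    rw [h.eq_singleton] at hz
    exact hzx hz
  · rintro u rfl w ⟨hw, hw'⟩ e
    exact hw' (hS w (hpS.subset hw) e)

/-- A vertex that is a middle vertex with respect to both sides is a hub: the two paths that show it
form a hole `W`, and the sectors of `W` through the other two vertices are long. -/
theorem TwoSided.mem_hubs_of_isMiddle [Finite V] {A B : Set V} {y : Fin 3 → V}
    (hAB : G.TwoSided A B y) {k : Fin 3} (hA : G.IsMiddle A y k) (hB : G.IsMiddle B y k)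
    (hθ : ¬ G.ContainsTheta) : y k ∈ G.hubs := by
  obtain ⟨i, j, S, hij, hik, hjk, hS, hSA, hSk⟩ := hA
  obtain ⟨T, hT, hTB, hTk⟩ : ∃ T, G.IndPath (y i) (y j) T ∧ (∀ x ∈ T, x ∈ B ∨ x = y i ∨ x = y j) ∧
      ∃ z ∈ T, G.Adj (y k) z := by
    obtain ⟨i', j', T, hij', hik', hjk', hT, hTB, hTk⟩ := hB
    by_cases h : i' = i
    · obtain rfl : j' = j := by omega
      subst h
      exact ⟨T, hT, fun x hx => hTB hx, hTk⟩
    · obtain rfl : i' = j := by omega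
      obtain rfl : j' = i := by omega
      exact ⟨T, hT.symm, fun x hx => (@hTB x hx).imp_right Or.symm, hTk⟩
  replace hSA : ∀ x ∈ S, x ∈ A ∨ x = y i ∨ x = y j := fun x hx => hSA hx
  have hkS : y k ∉ S := fun h => by
    rcases hSA _ h with h | h | h
    · exact hAB.left k h
    · exact hAB.inj i k hik h.symm
    · exact hAB.inj j k hjk h.symm
  have hkT : y k ∉ T := fun h => by
    rcases hTB _ h with h | h | h
    · exact hAB.right k h
    · exact hAB.inj i k hik h.symm
    · exact hAB.inj j k hjk h.symm
  have hNA : ∀ x ∈ S, G.Adj (y k) x → x ∈ A := fun x hx e => by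
    rcases hSA x hx with h | rfl | rfl
    · exact h
    · exact absurd e (hAB.stable _ _)
    · exact absurd e (hAB.stable _ _)
  have hNB : ∀ x ∈ T, G.Adj (y k) x → x ∈ B := fun x hx e => by
    rcases hTB x hx with h | rfl | rfl
    · exact h
    · exact absurd e (hAB.stable _ _)
    · exact absurd e (hAB.stable _ _)
  obtain ⟨p, hp, p', hp', S₁, S₂, S₃, hS₁, hS₂, hS₃, hSeq, hsepS, hsepS', hfS, hfS'⟩ :=
    hS.exists_first_last (N := G.neighborSet (y k)) hSk
  obtain ⟨q, hq, q', hq', T₁, T₂, T₃, hT₁, hT₂, hT₃, hTeq, hsepT, hsepT', hfT, hfT'⟩ :=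
    hT.exists_first_last (N := G.neighborSet (y k)) hTk
  rw [mem_neighborSet] at hp hp' hq hq'
  have hS₁S : S₁ ⊆ S := by rw [hSeq]; exact fun x hx => .inl (.inl hx)
  have hS₃S : S₃ ⊆ S := by rw [hSeq]; exact fun x hx => .inr hx
  have hT₁T : T₁ ⊆ T := by rw [hTeq]; exact fun x hx => .inl (.inl hx)
  have hT₃T : T₃ ⊆ T := by rw [hTeq]; exact fun x hx => .inr hx
  have hpA := hNA p (hS₁S hS₁.right_mem) hp
  have hp'A := hNA p' (hS₃S hS₃.left_mem) hp'
  have hqB := hNB q (hT₁T hT₁.right_mem) hq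
  have hq'B := hNB q' (hT₃T hT₃.left_mem) hq'
  have hAy : ∀ l, ∀ x ∈ A, y l ≠ x := fun l x hx h => hAB.left l (h ▸ hx)
  have hBy : ∀ l, ∀ x ∈ B, y l ≠ x := fun l x hx h => hAB.right l (h ▸ hx)
  by_cases hsingle : p = p' ∧ q = q'
  · -- with one neighbour on each path, `y k` is the middle of the third path of a theta
    obtain ⟨rfl, rfl⟩ := hsingle
    have huS : ∀ w ∈ S, G.Adj (y k) w → w = p := by
      intro w hw e
      rw [hSeq, hS₂.eq_singleton] at hw
      rcases hw with (hw | hw) | hw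
      exacts [hfS w hw e, hw, hfS' w hw e]
    have huT : ∀ w ∈ T, G.Adj (y k) w → w = q := by
      intro w hw e
      rw [hTeq, hT₂.eq_singleton] at hw
      rcases hw with (hw | hw) | hw
      exacts [hfT w hw e, hw, hfT' w hw e]
    obtain ⟨L, hL⟩ := exists_isClaw_of_unique hij hik hjk hS hSA (.nil (y k)) (fun x hx => .inr hx)
      (by rintro u rfl w hw; exact ⟨fun h => hkS (h ▸ hw), fun _ => rfl⟩)
      (hS₁S hS₁.right_mem) hpA hp huS
    obtain ⟨M, hM⟩ := exists_isClaw_of_unique hij hik hjk hT hTB (.nil (y k)) (fun x hx => .inr hx)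
      (by rintro u rfl w hw; exact ⟨fun h => hkT (h ▸ hw), fun _ => rfl⟩)
      (hT₁T hT₁.right_mem) hqB hq huT
    exact absurd (hL.containsTheta_of_centers hAB hM (hAB.sep p hpA q hqB).1
      (hAB.sep p hpA q hqB).2) hθ
  have h1A : ∀ x ∈ S₁, x ∈ A ∨ x = y i := fun x hx => by
    rcases hSA x (hS₁S hx) with h | h | rfl
    · exact .inl h
    · exact .inr h
    · exact absurd rfl (hsepS _ hx _ (.inr hS₃.right_mem) (hAy _ _ hpA) (hAy _ _ hpA)).1
  have h3A : ∀ x ∈ S₃, x ∈ A ∨ x = y j := fun x hx => by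
    rcases hSA x (hS₃S hx) with h | rfl | h
    · exact .inl h
    · exact absurd rfl (hsepS' _ (.inl hS₁.left_mem) _ hx (hAy _ _ hp'A) (hAy _ _ hp'A)).1
    · exact .inr h
  have h1B : ∀ x ∈ T₁, x ∈ B ∨ x = y i := fun x hx => by
    rcases hTB x (hT₁T hx) with h | h | rfl
    · exact .inl h
    · exact .inr h
    · exact absurd rfl (hsepT _ hx _ (.inr hT₃.right_mem) (hBy _ _ hqB) (hBy _ _ hqB)).1
  have h3B : ∀ x ∈ T₃, x ∈ B ∨ x = y j := fun x hx => by
    rcases hTB x (hT₃T hx) with h | rfl | h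
    · exact .inl h
    · exact absurd rfl (hsepT' _ (.inl hT₁.left_mem) _ hx (hBy _ _ hq'B) (hBy _ _ hq'B)).1
    · exact .inr h
  have hiW : y i ∈ S ∪ T := .inl hS.left_mem
  have hjW : y j ∈ S ∪ T := .inl hS.right_mem
  have hpW : p ∈ S ∪ T := .inl (hS₁S hS₁.right_mem)
  have hqW : q ∈ S ∪ T := .inr (hT₁T hT₁.right_mem)
  obtain ⟨t, htW, ht, htp, htq⟩ : ∃ t ∈ S ∪ T, G.Adj (y k) t ∧ t ≠ p ∧ t ≠ q := by
    by_cases hpp : p = p'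
    · exact ⟨q', .inr (hT₃T hT₃.left_mem), hq', (hAB.sep p hpA q' hq'B).1.symm,
        fun h => hsingle ⟨hpp, h.symm⟩⟩
    · exact ⟨p', .inl (hS₃S hS₃.left_mem), hp', Ne.symm hpp, (hAB.sep p' hp'A q hqB).1⟩
  have hpq := (hAB.sep p hpA q hqB).1
  have hne : ∀ l x, G.Adj (y k) x → y l ≠ x := fun l x e h => hAB.stable k l (h ▸ e)
  refine ⟨S ∪ T, hS.isHole_union hT (hAB.inj i j hij) (hAB.stable i j) ?_, ?_, ?_, ?_,
    S₁ ∪ T₁, S₃ ∪ T₃, ?_, ?_, ?_⟩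
  · intro u hu w hw h₁ h₂ h₃ h₄
    exact hAB.sep u ((hSA u hu).resolve_right (by tauto)) w ((hTB w hw).resolve_right (by tauto))
  · have hcard : ({y i, y j, p, q, t} : Set V).ncard = 5 := by
      rw [Set.ncard_insert_of_notMem, Set.ncard_insert_of_notMem, Set.ncard_insert_of_notMem,
        Set.ncard_pair htq.symm]
      · simp [hpq, htp.symm]
      · simp [hne j p hp, hne j q hq, hne j t ht]
      · simp [hne i p hp, hne i q hq, hne i t ht, hAB.inj i j hij]
    rw [← hcard]
    refine Set.ncard_le_ncard ?_ (Set.toFinite _)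
    rintro x (rfl | rfl | rfl | rfl | rfl) <;> assumption
  · rintro (h | h)
    exacts [hkS h, hkT h]
  · have hcard : ({p, q, t} : Set V).ncard = 3 := by
      rw [Set.ncard_insert_of_notMem, Set.ncard_pair htq.symm]
      simp [hpq, htp.symm]
    rw [← hcard]
    refine Set.ncard_le_ncard ?_ (Set.toFinite _)
    rintro x (rfl | rfl | rfl) <;> exact ⟨by assumption, by assumption⟩
  · intro h
    have : y i ∈ S₃ ∪ T₃ := h ▸ .inl hS₁.left_mem
    rcases this with h | h
    · exact (h3A _ h).elim (hAB.left i) (hAB.inj i j hij)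
    · exact (h3B _ h).elim (hAB.right i) (hAB.inj i j hij)
  · refine (hS₁.symm.append hT₁ ?_).isLongSector (Set.union_subset_union hS₁S hT₁T) hp hq ?_
      ⟨y i, .inl hS₁.left_mem, hAB.stable k i⟩
    · intro u hu w hw hu' hw'
      exact hAB.sep u ((h1A u hu).resolve_right hu') w ((h1B w hw).resolve_right hw')
    · rintro u (hu | hu) e
      exacts [.inl (hfS u hu e), .inr (hfT u hu e)]
  · refine (hS₃.append hT₃.symm ?_).isLongSector (Set.union_subset_union hS₃S hT₃T) hp' hq' ?_
      ⟨y j, .inl hS₃.right_mem, hAB.stable k j⟩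
    · intro u hu w hw hu' hw'
      exact hAB.sep u ((h3A u hu).resolve_right hu') w ((h3B w hw).resolve_right hw')
    · rintro u (hu | hu) e
      exacts [.inl (hfS' u hu e), .inr (hfT' u hu e)]

/-- Two disjoint anticomplete connected sets have no three pairwise non-adjacent common neighbours
other than hubs. -/
theorem TwoSided.exists_mem_hubs [Finite V] {A B : Set V} {y : Fin 3 → V}
    (hAB : G.TwoSided A B y) (hA : G.ConnectedIn A) (hB : G.ConnectedIn B)
    (hNA : ∀ i, ∃ u ∈ A, G.Adj (y i) u) (hNB : ∀ i, ∃ u ∈ B, G.Adj (y i) u)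
    (hθ : ¬ G.ContainsTheta) (hpyr : ¬ G.ContainsPyramid) (hpri : ¬ G.ContainsPrism) :
    ∃ k, y k ∈ G.hubs := by
  by_contra! hhub
  have hM : ∀ k, ¬ (G.IsMiddle A y k ∧ G.IsMiddle B y k) := fun k h =>
    hhub k (hAB.mem_hubs_of_isMiddle h.1 h.2 hθ)
  rcases hA.exists_isClaw_or_isTri hAB.left hAB.inj hAB.stable hNA with
    ⟨a, L, hL⟩ | ⟨a, L, hL⟩ <;>
  rcases hB.exists_isClaw_or_isTri hAB.right hAB.inj hAB.stable hNB with ⟨b, M, hM'⟩ | ⟨b, M, hM'⟩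
  · exact hθ (hL.containsTheta hAB hM hM')
  · exact hpyr (hL.containsPyramid hAB hM hM')
  · exact hpyr (hM'.containsPyramid hAB.symm (fun k h => hM k h.symm) hL)
  · exact hpri (hL.containsPrism hAB hM hM')

/-! ### Chordal graphs and minimal chordal completions -/

theorem IsHole.of_adj_iff {G' : SimpleGraph V} {W : Set V} (h : G.IsHole W)
    (hG : ∀ u ∈ W, ∀ v ∈ W, G.Adj u v ↔ G'.Adj u v) : G'.IsHole W := by
  obtain ⟨a, ha⟩ : W.Nonempty := by
    obtain ⟨u, c, -, -, -, rfl⟩ := h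
    exact ⟨u, c.start_mem_support⟩
  obtain ⟨b, c, S, hS, rfl, hab, hac, hbc, hbc', haS, hw⟩ := h.exists_indPath ha
  have hb : b ∈ insert a S := .inr hS.left_mem
  have hc : c ∈ insert a S := .inr hS.right_mem
  refine (hS.mono_of_adj_iff fun u hu v hv => hG u (.inr hu) v (.inr hv)).isHole_insert
    ((hG a ha b hb).1 hab) ((hG a ha c hc).1 hac) hbc (fun e => hbc' ((hG b hb c hc).2 e)) haS ?_
  exact fun w hw' e => hw w hw' ((hG a ha w (.inr hw')).2 e)

theorem addPairs_adj {F : Set (Sym2 V)} {u v : V} :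
    (G.addPairs F).Adj u v ↔ G.Adj u v ∨ s(u, v) ∈ F ∧ u ≠ v := by
  simp [addPairs, sup_adj, fromEdgeSet_adj]

/-- No chordal graph lies strictly between `G` and a minimal chordal completion of `G`. -/
theorem adj_of_minimal {F : Set (Sym2 V)} (hF : Minimal G.IsChordalCompletion F)
    {H' : SimpleGraph V} (h₁ : ∀ u v, G.Adj u v → H'.Adj u v)
    (h₂ : ∀ u v, H'.Adj u v → (G.addPairs F).Adj u v) (hH' : H'.IsChordalGraph) {u v : V}
    (huv : (G.addPairs F).Adj u v) : H'.Adj u v := by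
  have heq : G.addPairs (F ∩ H'.edgeSet) = H' := by
    ext a b
    rw [addPairs_adj]
    constructor
    · rintro (h | ⟨h, -⟩)
      exacts [h₁ a b h, h.2]
    · intro h
      rcases addPairs_adj.1 (h₂ a b h) with h' | h'
      exacts [.inl h', .inr ⟨⟨h'.1, h⟩, h'.2⟩]
  have hcomp : G.IsChordalCompletion (F ∩ H'.edgeSet) :=
    ⟨fun e he => hF.1.1 he.1, heq.symm ▸ hH'⟩
  rcases addPairs_adj.1 huv with h | h
  · exact h₁ u v h
  · exact (hF.2 hcomp Set.inter_subset_left h.1).2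

/-- A path that leaves `A ∪ S` meets `S` if `S` separates `A` from the rest. -/
theorem IndPath.exists_mem_separator {A S T : Set V} {b d : V} (h : G.IndPath b d T)
    (hA : ∀ u ∈ A, ∀ v, v ∉ A → v ∉ S → ¬ G.Adj u v) (hb : b ∈ A ∨ b ∈ S) (hd : d ∉ A)
    (hd' : d ∉ S) : ∃ s ∈ T, s ∈ S := by
  induction h with
  | nil x => exact (hb.elim hd hd').elim
  | @cons x z y T e p _ _ ih =>
    rcases hb with hx | hx
    · by_cases hz : z ∈ A ∨ z ∈ S
      · obtain ⟨s, hs, hs'⟩ := ih hz hd hd'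
        exact ⟨s, .inr hs, hs'⟩
      · push Not at hz
        exact absurd e (hA x hx z hz.1 hz.2)
    · exact ⟨x, .inl rfl, hx⟩

/-- If a clique `S` of a minimal chordal completion separates `A` from the rest in `G`, then it does
so in the completion: deleting the edges between `A` and the rest leaves a
graph glued along a clique from two induced subgraphs of the completion, which is chordal. -/
theorem not_adj_of_separator {F : Set (Sym2 V)} (hF : Minimal G.IsChordalCompletion F) {A S : Set V}
    (hS : (G.addPairs F).IsClique S) (hAS : ∀ u ∈ A, u ∉ S)
    (hA : ∀ u ∈ A, ∀ v, v ∉ A → v ∉ S → ¬ G.Adj u v) {u v : V} (hu : u ∈ A) (hv : v ∉ A)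
    (hv' : v ∉ S) : ¬ (G.addPairs F).Adj u v := by
  set H := G.addPairs F with hH
  let H' : SimpleGraph V :=
    { Adj := fun a b => H.Adj a b ∧ ¬ (a ∈ A ∧ b ∉ A ∧ b ∉ S) ∧ ¬ (b ∈ A ∧ a ∉ A ∧ a ∉ S)
      symm := ⟨fun a b h => ⟨h.1.symm, h.2.2, h.2.1⟩⟩
      loopless := ⟨fun a h => H.irrefl h.1⟩ }
  have hA' : ∀ u ∈ A, ∀ v, v ∉ A → v ∉ S → ¬ H'.Adj u v := fun u hu v h₁ h₂ h => h.2.1 ⟨hu, h₁, h₂⟩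
  suffices hch : H'.IsChordalGraph by
    intro h
    refine hA' u hu v hv hv' (adj_of_minimal hF (H' := H')
      (fun a b hab => ⟨addPairs_adj.2 (.inl hab), ?_, ?_⟩) (fun a b h => h.1) hch h)
    · exact fun h => hA a h.1 b h.2.1 h.2.2 hab
    · exact fun h => hA b h.1 a h.2.1 h.2.2 hab.symm
  intro W hW
  by_cases hWA : ∃ a ∈ W, a ∈ A
  swap
  · push Not at hWA
    refine hF.1.2 W (hW.of_adj_iff fun a ha b hb => ⟨fun h => h.1, fun h => ⟨h, ?_, ?_⟩⟩)
    exacts [fun h => hWA a ha h.1, fun h => hWA b hb h.1]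
  by_cases hWB : ∃ d ∈ W, d ∉ A ∧ d ∉ S
  swap
  · push Not at hWB
    refine hF.1.2 W (hW.of_adj_iff fun a ha b hb => ⟨fun h => h.1, fun h => ⟨h, ?_, ?_⟩⟩)
    exacts [fun h => h.2.2 (hWB b hb h.2.1), fun h => h.2.2 (hWB a ha h.2.1)]
  -- the two paths of the hole between `a` and `d` meet `S` in non-adjacent vertices
  obtain ⟨a, ha, haA⟩ := hWA
  obtain ⟨d, hd, hdA, hdS⟩ := hWB
  obtain ⟨b, c, P, hP, rfl, hab, hac, -, -, -, -⟩ := hW.exists_indPath ha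
  have hdP : d ∈ P := hd.resolve_left fun h => hdA (h ▸ haA)
  have hside : ∀ b, H'.Adj a b → b ∈ A ∨ b ∈ S := fun b h => by
    by_contra! hb
    exact hA' a haA b hb.1 hb.2 h
  obtain ⟨P₁, P₂, hP₁, hP₂, rfl, hsep⟩ := hP.exists_split hdP
  obtain ⟨s, hs, hsS⟩ := hP₁.exists_mem_separator hA' (hside b hab) hdA hdS
  obtain ⟨t, ht, htS⟩ := hP₂.symm.exists_mem_separator hA' (hside c hac) hdA hdS
  have hst := hsep s hs t ht (fun h => hdS (h ▸ hsS)) (fun h => hdS (h ▸ htS))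
  exact hst.2 ⟨hS hsS htS hst.1, fun h => hAS s h.1 hsS, fun h => hAS t h.1 htS⟩

/-- A fill edge `xy` of a minimal chordal completion is the only chord of a cycle of
length four. -/
theorem exists_common_neighbors {F : Set (Sym2 V)} (hF : Minimal G.IsChordalCompletion F) {x y : V}
    (hxy : (G.addPairs F).Adj x y) (hG : ¬ G.Adj x y) :
    ∃ u v, u ≠ v ∧ ¬ (G.addPairs F).Adj u v ∧ (G.addPairs F).Adj x u ∧ (G.addPairs F).Adj x v ∧
      (G.addPairs F).Adj y u ∧ (G.addPairs F).Adj y v := by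
  set H := G.addPairs F with hH
  let H' : SimpleGraph V :=
    { Adj := fun a b => H.Adj a b ∧ ¬ (a = x ∧ b = y) ∧ ¬ (a = y ∧ b = x)
      symm := ⟨fun a b h => ⟨h.1.symm, by tauto, by tauto⟩⟩
      loopless := ⟨fun a h => H.irrefl h.1⟩ }
  have hch : ¬ H'.IsChordalGraph := fun hch => by
    refine (adj_of_minimal hF (H' := H') (fun a b hab => ⟨addPairs_adj.2 (.inl hab), ?_, ?_⟩)
      (fun a b h => h.1) hch hxy).2.1 ⟨rfl, rfl⟩
    · rintro ⟨rfl, rfl⟩; exact hG hab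
    · rintro ⟨rfl, rfl⟩; exact hG hab.symm
  simp only [IsChordalGraph, not_forall, not_not] at hch
  obtain ⟨W, hW⟩ := hch
  have hxW : x ∈ W := by
    by_contra hx
    refine hF.1.2 W (hW.of_adj_iff fun a ha b hb => ⟨fun h => h.1, fun h => ⟨h, ?_, ?_⟩⟩)
    · rintro ⟨rfl, -⟩; exact hx ha
    · rintro ⟨-, rfl⟩; exact hx hb
  have hyW : y ∈ W := by
    by_contra hy
    refine hF.1.2 W (hW.of_adj_iff fun a ha b hb => ⟨fun h => h.1, fun h => ⟨h, ?_, ?_⟩⟩)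
    · rintro ⟨-, rfl⟩; exact hy hb
    · rintro ⟨rfl, -⟩; exact hy ha
  obtain ⟨b, c, P, hP, rfl, hxb, hxc, hbc, hbc', hxP, hxn⟩ := hW.exists_indPath hxW
  have hyP : y ∈ P := hyW.resolve_left hxy.ne'
  -- a common statement for the two paths of the hole from the neighbours of `x` to `y`
  have key : ∀ b P, H'.IndPath b y P → H'.Adj x b → x ∉ P → (∀ w ∈ P, H'.Adj x w → w = b) →
      H.Adj y b := by
    intro b P hP hxb hxP hxn
    by_contra hyb
    have hby : b ≠ y := by rintro rfl; exact hxb.2.1 ⟨rfl, rfl⟩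
    refine hF.1.2 _ ((hP.mono_of_adj_iff (G' := H) fun u hu v hv => ⟨fun h => h.1, fun h =>
      ⟨h, ?_, ?_⟩⟩).isHole_insert hxb.1 hxy hby (fun h => hyb h.symm) hxP ?_)
    · rintro ⟨rfl, -⟩; exact hxP hu
    · rintro ⟨-, rfl⟩; exact hxP hv
    · intro w hw e
      by_cases hwy : w = y
      · exact .inr hwy
      · exact .inl (hxn w hw ⟨e, fun h => hwy h.2, fun h => hxP (h.2 ▸ hw)⟩)
  obtain ⟨P₁, P₂, hP₁, hP₂, rfl, hsep⟩ := hP.exists_split hyP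
  have hby : b ≠ y := by rintro rfl; exact hxb.2.1 ⟨rfl, rfl⟩
  have hcy : c ≠ y := by rintro rfl; exact hxc.2.1 ⟨rfl, rfl⟩
  refine ⟨b, c, hbc, fun h => hbc' ⟨h, ?_, ?_⟩, hxb.1, hxc.1,
    key b P₁ hP₁ hxb (fun h => hxP (.inl h)) ?_, key c P₂ hP₂.symm hxc (fun h => hxP (.inr h)) ?_⟩
  · exact fun h => hcy h.2
  · exact fun h => hby h.1
  · intro w hw e
    rcases hxn w (.inl hw) e with h | rfl
    · exact h
    · exact absurd rfl (hsep w hw w hP₂.right_mem hcy hcy).1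
  · intro w hw e
    rcases hxn w (.inr hw) e with rfl | h
    · exact absurd rfl (hsep w hP₁.left_mem w hw hby hby).1
    · exact h

/-- In a chordal graph, if every vertex of a clique `X` has a neighbour in a connected
set `D`, then some vertex of `D` is adjacent to all of `X`. -/
theorem IsChordalGraph.exists_forall_adj [Finite V] (hG : G.IsChordalGraph) {X D : Set V}
    (hX : G.IsClique X) (hD : G.ConnectedIn D) (hXD : ∀ x ∈ X, x ∉ D) (hne : D.Nonempty)
    (hN : ∀ x ∈ X, ∃ d ∈ D, G.Adj x d) : ∃ d ∈ D, ∀ x ∈ X, G.Adj d x := by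
  obtain ⟨d, hd, hmax⟩ := Set.exists_max_image D (fun d => (X ∩ G.neighborSet d).ncard)
    (Set.toFinite D) hne
  refine ⟨d, hd, ?_⟩
  by_contra! h
  obtain ⟨x, hx, hdx⟩ := h
  obtain ⟨e₀, he₀, hxe₀⟩ := hN x hx
  obtain ⟨p, hp⟩ := hD e₀ he₀ d hd
  obtain ⟨S, hSD, hS⟩ := IndPath.exists_of_walk (A := insert x D) (.cons hxe₀ p) (by
    intro z hz
    rw [Walk.support_cons, List.mem_cons] at hz
    exact hz.imp_right (hp z))
  cases hS with
  | nil => exact hXD _ hx hd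
  | @cons x e _ S hxe hS hxS hnb =>
  have hSD' : S ⊆ D := fun z hz => (hSD (.inr hz)).resolve_left fun h => hxS (h ▸ hz)
  -- `e`, the neighbour of `x` on an induced path to `d`, has more neighbours in `X` than `d`
  have hsub : X ∩ G.neighborSet d ⊆ X ∩ G.neighborSet e := by
    rintro z ⟨hz, hdz⟩
    refine ⟨hz, ?_⟩
    by_contra hez
    have hzx : z ≠ x := by rintro rfl; exact hdx hdz
    obtain ⟨z', hz', S₁, S₂, hS₁, -, rfl, -, hf⟩ :=
      hS.exists_first (N := G.neighborSet z) ⟨d, hS.right_mem, hdz.symm⟩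
    have hz'e : z' ≠ e := by rintro rfl; exact hez hz'.symm
    have hxS₁ : G.IndPath x z' (insert x S₁) := .cons hxe hS₁ (fun h => hxS (.inl h))
      fun w hw => hnb w (.inl hw)
    refine hG _ (hxS₁.isHole_insert (a := z) (hX hz hx hzx) hz' ?_ ?_ ?_ ?_)
    · rintro rfl; exact hxS (.inl hS₁.right_mem)
    · exact fun h => hz'e (hnb z' (.inl hS₁.right_mem) h)
    · rintro (h | h)
      exacts [hzx h, hXD z hz (hSD' (.inl h))]
    · rintro w (hw | hw) hzw
      exacts [.inl hw, .inr (hf w hw hzw)]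
  have hlt := Set.ncard_lt_ncard (hsub.ssubset_of_mem_notMem (a := x) ⟨hx, hxe.symm⟩
    fun h => hdx h.2) (Set.toFinite _)
  exact absurd (hmax e (hSD' hS.left_mem)) (by simpa using hlt)

/-! ### Potential maximal cliques -/

/-- The set of vertices reached from `u` by walks that avoid `X`: the component of `u` in `G \ X`
(empty if `u ∈ X`). -/
def outComp (G : SimpleGraph V) (X : Set V) (u : V) : Set V :=
  {v | ∃ p : G.Walk u v, ∀ z ∈ p.support, z ∉ X}

section outComp

variable {X : Set V} {u v w : V}

theorem self_mem_outComp (hu : u ∉ X) : u ∈ G.outComp X u :=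
  ⟨.nil, by simpa using hu⟩

theorem notMem_of_mem_outComp (h : v ∈ G.outComp X u) : v ∉ X := by
  obtain ⟨p, hp⟩ := h
  exact hp v p.end_mem_support

theorem mem_outComp_of_adj (h : v ∈ G.outComp X u) (e : G.Adj v w) (hw : w ∉ X) :
    w ∈ G.outComp X u := by
  obtain ⟨p, hp⟩ := h
  refine ⟨p.concat e, fun z hz => ?_⟩
  simp only [Walk.support_concat, List.mem_append, List.mem_singleton] at hz
  rcases hz with hz | rfl
  exacts [hp z hz, hw]

theorem outComp_eq_of_mem (h : v ∈ G.outComp X u) : G.outComp X v = G.outComp X u := by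
  obtain ⟨p, hp⟩ := h
  ext w
  constructor
  · rintro ⟨q, hq⟩
    refine ⟨p.append q, fun z hz => ?_⟩
    rcases (Walk.mem_support_append_iff _ _).1 hz with h | h
    exacts [hp z h, hq z h]
  · rintro ⟨q, hq⟩
    refine ⟨p.reverse.append q, fun z hz => ?_⟩
    rcases (Walk.mem_support_append_iff _ _).1 hz with h | h
    exacts [hp z (by simpa using h), hq z h]

theorem connectedIn_outComp : G.ConnectedIn (G.outComp X u) := by
  intro v hv w hw
  rw [← outComp_eq_of_mem hv] at hw
  obtain ⟨p, hp⟩ := hw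
  refine ⟨p, fun z hz => ?_⟩
  classical
  rw [← outComp_eq_of_mem hv]
  exact ⟨p.takeUntil z hz, fun t ht => hp t (p.support_takeUntil_subset_support hz ht)⟩

/-- A connected set avoiding `X` and touching the component of `u` is part of it. -/
theorem ConnectedIn.subset_outComp {D : Set V} (hD : G.ConnectedIn D) (hDX : ∀ z ∈ D, z ∉ X)
    (hv : v ∈ D) (hvu : v ∈ G.outComp X u) : D ⊆ G.outComp X u := by
  intro w hw
  obtain ⟨p, hp⟩ := hD v hv w hw
  rw [← outComp_eq_of_mem hvu]
  exact ⟨p, fun z hz => hDX z (hp z hz)⟩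

end outComp

theorem ConnectedIn.mono {G' : SimpleGraph V} (hG : G ≤ G') {A : Set V} (h : G.ConnectedIn A) :
    G'.ConnectedIn A := by
  intro u hu v hv
  obtain ⟨p, hp⟩ := h u hu v hv
  exact ⟨p.mapLe hG, by simpa using hp⟩

/-- Two non-adjacent vertices of a potential maximal clique `X` both have neighbours in some
component of `G \ X`. -/
theorem IsPMC.exists_common_outComp {X : Set V} (hX : G.IsPMC X) {x y : V} (hx : x ∈ X)
    (hy : y ∈ X) (hxy : x ≠ y) (hG : ¬ G.Adj x y) :
    ∃ u ∉ X, (∃ d ∈ G.outComp X u, G.Adj x d) ∧ ∃ d ∈ G.outComp X u, G.Adj y d := by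
  obtain ⟨F, hF, hXc, -⟩ := hX
  obtain ⟨u, v, huv, huv', hxu, hxv, hyu, hyv⟩ := exists_common_neighbors hF (hXc hx hy hxy) hG
  -- the completion adds no neighbours to a component of `G \ X`
  have key : ∀ u ∉ X, ∀ x ∈ X, (G.addPairs F).Adj x u → ∃ d ∈ G.outComp X u, G.Adj x d := by
    intro u hu x hx hxu
    by_contra h
    refine not_adj_of_separator hF (A := G.outComp X u)
      (S := {z ∈ X | ∃ d ∈ G.outComp X u, G.Adj z d})
      (hXc.subset fun z hz => hz.1) (fun z hz hz' => notMem_of_mem_outComp hz hz'.1) ?_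
      (self_mem_outComp hu) (fun h => notMem_of_mem_outComp h hx) (fun h' => h h'.2) hxu.symm
    intro a ha b hb hb' hab
    by_cases hbX : b ∈ X
    · exact hb' ⟨hbX, a, ha, hab.symm⟩
    · exact hb (mem_outComp_of_adj ha hab hbX)
  by_cases hu : u ∈ X
  · have hv : v ∉ X := fun hv => huv' (hXc hu hv huv)
    exact ⟨v, hv, key v hv x hx hxv, key v hv y hy hyv⟩
  · exact ⟨u, hu, key u hu x hx hxu, key u hu y hy hyu⟩

/-- A component of `G \ X`, for a potential maximal clique `X`, is not attached to all of `X`. -/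
theorem IsPMC.exists_not_adj_outComp [Finite V] {X : Set V} (hX : G.IsPMC X) {u : V} (hu : u ∉ X) :
    ∃ x ∈ X, ∀ d ∈ G.outComp X u, ¬ G.Adj x d := by
  obtain ⟨F, hF, hXc, hmax⟩ := hX
  have hle : G ≤ G.addPairs F := fun a b h => addPairs_adj.2 (.inl h)
  by_contra! h
  obtain ⟨d, hd, hdX⟩ := hF.1.2.exists_forall_adj hXc
    ((connectedIn_outComp (G := G) (X := X) (u := u)).mono hle)
    (fun x hx hx' => notMem_of_mem_outComp hx' hx) ⟨u, self_mem_outComp hu⟩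
    fun x hx => (h x hx).imp fun d hd => ⟨hd.1, hle hd.2⟩
  have := hmax (y := insert d X) (hXc.insert fun x hx _ => hdX x hx) (Set.subset_insert _ _)
    (Set.mem_insert d X)
  exact notMem_of_mem_outComp hd this

/-- Let `X` be a potential maximal clique and `D` a component of `G \ X`. Among three pairwise
non-adjacent vertices of `X` with neighbours in `D` there is a hub. The second connected set
attached to them is the component, in `G` without the neighbourhood of `D`, of a vertex `x₀ ∈ X` with no
neighbour in `D`. -/
theorem IsPMC.exists_mem_hubs [Finite V] {X : Set V} (hX : G.IsPMC X) (hθ : ¬ G.ContainsTheta)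
    (hpyr : ¬ G.ContainsPyramid) (hpri : ¬ G.ContainsPrism) {u : V} (hu : u ∉ X) {y : Fin 3 → V}
    (hy : ∀ i, y i ∈ X) (hinj : ∀ i j, i ≠ j → y i ≠ y j) (hst : ∀ i j, ¬ G.Adj (y i) (y j))
    (hN : ∀ i, ∃ d ∈ G.outComp X u, G.Adj (y i) d) : ∃ k, y k ∈ G.hubs := by
  obtain ⟨x₀, hx₀, hx₀D⟩ := hX.exists_not_adj_outComp hu
  set D := G.outComp X u with hDdef
  set S : Set V := {x ∈ X | ∃ d ∈ D, G.Adj x d} with hS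
  have hx₀S : x₀ ∉ S := by
    rintro ⟨-, d, hd, h⟩
    exact hx₀D d hd h
  have hstep : ∀ v w, v ∉ D → v ∉ S → w ∈ D → ¬ G.Adj v w := by
    intro v w hv hvS hw e
    by_cases hvX : v ∈ X
    · exact hvS ⟨hvX, w, hw, e⟩
    · exact hv (mem_outComp_of_adj hw e.symm hvX)
  have hBD : ∀ w ∈ G.outComp S x₀, w ∉ D := by
    rintro w ⟨p, hp⟩
    have hx₀D' : x₀ ∉ D := fun h => notMem_of_mem_outComp h hx₀
    clear hx₀ hx₀D hx₀S
    induction p with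
    | nil => exact hx₀D'
    | @cons a b c e p ih =>
      refine ih (fun z hz => hp z (by simp [hz])) fun hb => ?_
      exact hstep a b hx₀D' (hp a (by simp)) hb e
  have hAB : G.TwoSided D (G.outComp S x₀) y := by
    refine ⟨fun d hd b hb => ⟨?_, fun e => ?_⟩, fun i h => notMem_of_mem_outComp h (hy i),
      fun i h => notMem_of_mem_outComp h ⟨hy i, hN i⟩, hinj, hst⟩
    · rintro rfl; exact hBD d hb hd
    · exact hstep b d (hBD b hb) (notMem_of_mem_outComp hb) hd e.symm
  refine hAB.exists_mem_hubs connectedIn_outComp connectedIn_outComp hN (fun i => ?_) hθ hpyr hpri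
  by_cases hadj : G.Adj (y i) x₀
  · exact ⟨x₀, self_mem_outComp hx₀S, hadj⟩
  have hne : y i ≠ x₀ := by
    intro h
    exact hx₀S (h ▸ ⟨hy i, hN i⟩)
  obtain ⟨u', -, ⟨d, hd, hyd⟩, e, he, hx₀e⟩ := hX.exists_common_outComp (hy i) hx₀ hne hadj
  refine ⟨d, ?_, hyd⟩
  have hDS : ∀ z ∈ G.outComp X u', z ∉ S := fun z hz h => notMem_of_mem_outComp hz h.1
  exact connectedIn_outComp.subset_outComp hDS he
    (mem_outComp_of_adj (self_mem_outComp hx₀S) hx₀e (hDS e he)) hd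

/-! ### The bounds -/

/-- Four pairwise non-adjacent non-hubs of a potential maximal clique would be the branch vertices
of an induced subdivision of `K_4`, which contains a theta. -/
theorem IsPMC.ncard_le_three [Finite V] {X : Set V} (hX : G.IsPMC X) (hθ : ¬ G.ContainsTheta)
    (hpyr : ¬ G.ContainsPyramid) (hpri : ¬ G.ContainsPrism) {Y : Set V} (hYX : Y ⊆ X \ G.hubs)
    (hY : G.IsIndepSet Y) : Y.ncard ≤ 3 := by
  by_contra! hcard
  obtain ⟨y, hyY, hinj⟩ : ∃ y : Fin 4 → V, (∀ i, y i ∈ Y) ∧ Function.Injective y := by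
    classical
    have := Fintype.ofFinite Y
    have hc : Fintype.card (Fin 4) ≤ Fintype.card Y := by
      rw [Fintype.card_fin, ← Nat.card_eq_fintype_card]
      exact hcard
    obtain ⟨f⟩ := Function.Embedding.nonempty_of_card_le hc
    exact ⟨fun i => f i, fun i => (f i).2, fun i j h => f.injective (Subtype.ext h)⟩
  have hyX : ∀ i, y i ∈ X := fun i => (hYX (hyY i)).1
  have hne : ∀ i j, i ≠ j → y i ≠ y j := fun i j h e => h (hinj e)
  have hst : ∀ i j, ¬ G.Adj (y i) (y j) := by
    intro i j h
    exact hY (hyY i) (hyY j) h.ne h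
  have hex : ∀ i j, i ≠ j → ∃ u ∉ X, (∃ d ∈ G.outComp X u, G.Adj (y i) d) ∧
      ∃ d ∈ G.outComp X u, G.Adj (y j) d := fun i j h =>
    hX.exists_common_outComp (hyX i) (hyX j) (hne i j h) (hst i j)
  have huniq : ∀ i j k, i ≠ j → i ≠ k → j ≠ k → ∀ u ∉ X, (∃ d ∈ G.outComp X u, G.Adj (y i) d) →
      (∃ d ∈ G.outComp X u, G.Adj (y j) d) → ¬ ∃ d ∈ G.outComp X u, G.Adj (y k) d := by
    intro i j k hij hik hjk u hu hi hj hk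
    obtain ⟨l, hl⟩ := hX.exists_mem_hubs hθ hpyr hpri hu (y := ![y i, y j, y k])
      (by intro l; fin_cases l <;> exact hyX _)
      (by
        intro l m hlm
        fin_cases l <;> fin_cases m <;>
          first
          | exact absurd rfl hlm
          | exact hne _ _ (by assumption)
          | exact (hne _ _ (by assumption)).symm)
      (by intro l m; fin_cases l <;> fin_cases m <;> exact hst _ _)
      (by intro l; fin_cases l <;> assumption)
    fin_cases l
    exacts [(hYX (hyY i)).2 hl, (hYX (hyY j)).2 hl, (hYX (hyY k)).2 hl]
  have : Nonempty V := ⟨y 0⟩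
  choose! u huX hui huj using hex
  -- `D i j` is the component through which `y i` and `y j` are joined
  set D : Fin 4 → Fin 4 → Set V := fun i j => G.outComp X (u i j) with hDdef
  have hyD : ∀ k i j, i ≠ j → i ≠ k → j ≠ k → ∀ x ∈ D i j, y k ≠ x ∧ ¬ G.Adj (y k) x := by
    intro k i j hij hik hjk x hx
    refine ⟨?_, fun e => ?_⟩
    · rintro rfl
      exact notMem_of_mem_outComp hx (hyX k)
    · exact huniq i j k hij hik hjk _ (huX i j hij) (hui i j hij) (huj i j hij) ⟨x, hx, e⟩
  have hDD : ∀ i j k l, i ≠ j → k ≠ l → ¬ (k = i ∧ l = j) → ¬ (k = j ∧ l = i) →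
      ∀ x ∈ D i j, ∀ z ∈ D k l, x ≠ z ∧ ¬ G.Adj x z := by
    intro i j k l hij hkl h₁ h₂ x hx z hz
    have hdisj : z ∉ D i j := by
      intro hz'
      have heq : D k l = D i j := (outComp_eq_of_mem hz).symm.trans (outComp_eq_of_mem hz')
      obtain ⟨d, hd, hkd⟩ := hui k l hkl
      obtain ⟨e, he, hle⟩ := huj k l hkl
      change d ∈ D k l at hd
      change e ∈ D k l at he
      rw [heq] at hd he
      by_cases hk : i ≠ k ∧ j ≠ k
      · exact (hyD k i j hij hk.1 hk.2 d hd).2 hkd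
      · exact (hyD l i j hij (by omega) (by omega) e he).2 hle
    refine ⟨?_, fun e => hdisj (mem_outComp_of_adj hx e (notMem_of_mem_outComp hz))⟩
    rintro rfl
    exact hdisj hx
  have hpath : ∀ i j, i ≠ j → ∃ S, (∀ x ∈ S, x ∈ D i j ∨ x = y i ∨ x = y j) ∧
      G.IndPath (y i) (y j) S := fun i j hij => by
    obtain ⟨S, hS, hp⟩ := connectedIn_outComp.exists_indPath (hui i j hij) (huj i j hij)
    exact ⟨S, fun x hx => hS hx, hp⟩
  choose! S hSD hS using hpath
  have happ : ∀ k, k ≠ 0 → k ≠ 1 → G.IndPath (y 0) (y 1) (S 0 k ∪ S k 1) := by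
    intro k h0 h1
    refine (hS 0 k h0.symm).append (hS k 1 h1) ?_
    intro a ha b hb hak hbk
    rcases hSD 0 k h0.symm a ha with ha | rfl | rfl
    · rcases hSD k 1 h1 b hb with hb | rfl | rfl
      · exact hDD 0 k k 1 h0.symm h1 (by simp [h0]) (by simp) a ha b hb
      · exact absurd rfl hbk
      · have := hyD 1 0 k h0.symm (by decide) h1 a ha
        exact ⟨this.1.symm, fun e => this.2 e.symm⟩
    · rcases hSD k 1 h1 b hb with hb | rfl | rfl
      · exact hyD 0 k 1 h1 h0 (by decide) b hb
      · exact absurd rfl hbk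
      · exact ⟨hne 0 1 (by decide), hst 0 1⟩
    · exact absurd rfl hak
  refine hθ (containsTheta_of_indPath (a := y 0) (b := y 1)
    (S := ![S 0 1, S 0 2 ∪ S 2 1, S 0 3 ∪ S 3 1]) (hne 0 1 (by decide)) (hst 0 1) ?_ ?_)
  · intro i
    fin_cases i
    · exact hS 0 1 (by decide)
    · exact happ 2 (by decide) (by decide)
    · exact happ 3 (by decide) (by decide)
  · have hint : ∀ k, k ≠ 0 → k ≠ 1 → ∀ x ∈ S 0 k ∪ S k 1, x ≠ y 0 → x ≠ y 1 →
        x ∈ D 0 k ∨ x ∈ D k 1 ∨ x = y k := by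
      rintro k h0 h1 x (hx | hx) hx0 hx1
      · rcases hSD 0 k h0.symm x hx with h | h | h <;> tauto
      · rcases hSD k 1 h1 x hx with h | h | h <;> tauto
    have h01 : ∀ k, k ≠ 0 → k ≠ 1 → ∀ x ∈ S 0 1, ∀ z ∈ S 0 k ∪ S k 1, x ≠ y 0 → x ≠ y 1 →
        z ≠ y 0 → z ≠ y 1 → x ≠ z ∧ ¬ G.Adj x z := by
      intro k h0 h1 x hx z hz hx0 hx1 hz0 hz1
      have hx' : x ∈ D 0 1 := (hSD 0 1 (by decide) x hx).resolve_right (by tauto)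
      rcases hint k h0 h1 z hz hz0 hz1 with hz | hz | rfl
      · exact hDD 0 1 0 k (by decide) h0.symm (by simp [h1]) (by simp) x hx' z hz
      · exact hDD 0 1 k 1 (by decide) h1 (by simp [h0]) (by simp) x hx' z hz
      · have := hyD k 0 1 (by decide) h0.symm h1.symm x hx'
        exact ⟨this.1.symm, fun e => this.2 e.symm⟩
    have h23 : ∀ x ∈ S 0 2 ∪ S 2 1, ∀ z ∈ S 0 3 ∪ S 3 1, x ≠ y 0 → x ≠ y 1 →
        z ≠ y 0 → z ≠ y 1 → x ≠ z ∧ ¬ G.Adj x z := by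
      intro x hx z hz hx0 hx1 hz0 hz1
      rcases hint 2 (by decide) (by decide) x hx hx0 hx1 with hx | hx | rfl <;>
      rcases hint 3 (by decide) (by decide) z hz hz0 hz1 with hz | hz | rfl <;>
      first
      | exact hDD _ _ _ _ (by decide) (by decide) (by decide) (by decide) _ hx _ hz
      | exact hyD _ _ _ (by decide) (by decide) (by decide) _ hz
      | exact ⟨(hyD _ _ _ (by decide) (by decide) (by decide) _ hx).1.symm, fun e =>
          (hyD _ _ _ (by decide) (by decide) (by decide) _ hx).2 e.symm⟩
      | exact ⟨hne 2 3 (by decide), hst 2 3⟩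
    have swap : ∀ {S T : Set V}, (∀ x ∈ S, ∀ z ∈ T, x ≠ y 0 → x ≠ y 1 → z ≠ y 0 → z ≠ y 1 →
        x ≠ z ∧ ¬ G.Adj x z) → ∀ x ∈ T, ∀ z ∈ S, x ≠ y 0 → x ≠ y 1 → z ≠ y 0 → z ≠ y 1 →
        x ≠ z ∧ ¬ G.Adj x z := fun h x hx z hz a b c d =>
      ⟨(h z hz x hx c d a b).1.symm, fun e => (h z hz x hx c d a b).2 e.symm⟩
    intro i j hij
    fin_cases i <;> fin_cases j
    · exact absurd rfl hij
    · exact h01 2 (by decide) (by decide)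
    · exact h01 3 (by decide) (by decide)
    · exact swap (h01 2 (by decide) (by decide))
    · exact absurd rfl hij
    · exact h23
    · exact swap (h01 3 (by decide) (by decide))
    · exact swap h23
    · exact absurd rfl hij

theorem ncard_le_ramseyNumber [Finite V] {t s : ℕ} (hG : G.CliqueFree t) {Z : Set V}
    (hZ : ∀ Y ⊆ Z, G.IsIndepSet Y → Y.ncard < s) : Z.ncard ≤ ramseyNumber t s := by
  by_contra! hlt
  have hR : RamseyBound t s (ramseyNumber t s) := Nat.sInf_mem (exists_ramseyBound t s)
  have e : Fin Z.ncard ≃ Z := (Finite.equivFin Z).symm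
  let f : Fin Z.ncard ↪ V := e.toEmbedding.trans (Function.Embedding.subtype _)
  rcases hR Z.ncard hlt.le (G.comap f) with h | h
  · exact h (hG.comap ⟨(Embedding.comap f G).toCopy⟩)
  · simp only [IndepSetFree, not_forall, not_not] at h
    obtain ⟨B, hB, hBs⟩ := h
    have := hZ (B.map f) ?_ ?_
    · rw [Set.ncard_coe_finset, Finset.card_map, hBs] at this
      exact lt_irrefl _ this
    · intro x hx
      obtain ⟨b, -, rfl⟩ := Finset.mem_map.1 (Finset.mem_coe.1 hx)
      exact (e b).2
    · intro x hx z hz hxz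
      obtain ⟨a, ha, rfl⟩ := Finset.mem_map.1 (Finset.mem_coe.1 hx)
      obtain ⟨b, hb, rfl⟩ := Finset.mem_map.1 (Finset.mem_coe.1 hz)
      exact hB ha hb (fun h => hxz (h ▸ rfl))

end SimpleGraph

theorem theorem4p4 {V : Type*} [Finite V] (t : ℕ) (ht : 1 ≤ t) (G : SimpleGraph V)
    (hG : G.InClassC t) (X : Set V) (hX : G.IsPMC X) :
    (∀ Y : Set V, Y ⊆ X \ G.hubs → G.IsIndepSet Y → Y.ncard ≤ 3) ∧
      (X \ G.hubs).ncard ≤ SimpleGraph.ramseyNumber t 4 := by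
  obtain ⟨hθ, hpyr, hpri, -, hfree⟩ := hG
  have h : ∀ Y : Set V, Y ⊆ X \ G.hubs → G.IsIndepSet Y → Y.ncard ≤ 3 := fun Y hYX hY =>
    hX.ncard_le_three hθ hpyr hpri hYX hY
  exact ⟨h, SimpleGraph.ncard_le_ramseyNumber hfree fun Y hYX hY => Nat.lt_succ_of_le (h Y hYX hY)⟩
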